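/- Let $m,n,p$ be nonnegative integers, and equip $\mathbb{R}^{m\times n}$ with the trace inner product $\langle X,Y\rangle=\sum_{i,j}X_{ij}Y_{ij}$ and the Frobenius norm. Let $\|X\|_*$ denote the nuclear norm (the sum of the singular values of $X$). For $k=1,\dots,p$ let $f_k:\mathbb{R}^{m\times n}\to\mathbb{R}\cup\{\infty\}$ be proper and closed (lower semicontinuous), and suppose that there are real symmetric matrices $A_{00}^k$, $A_0^k$, $A_{ij}^k$ ($1\le i\le m$, $1\le j\le n$), of a common size $d_k\times d_k$ for each $k$, such that $$\{(X,t)\in\mathbb{R}^{m\times n}\times\mathbb{R}:\ f_k(X)\le t\}=\Big\{(X,t):\ A_{00}^k+\sum_{i=1}^m\sum_{j=1}^n A_{ij}^kX_{ij}+A_0^k t\succeq 0\Big\}.$$ Suppose in addition that there exist $X^s\in\mathbb{R}^{m\times n}$ and $s^s\in\mathbb{R}^p$ such that for every $k=1,\dots,p$ $$A_{00}^k+\sum_{i=1}^m\sum_{j=1}^n A_{ij}^kX^s_{ij}+A_0^k s^s_k\succ 0 .$$ Define $f(X)=\sum_{k=1}^p f_k(X)+\|X\|_*$, let $\partial$ denote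 the limiting subdifferential and $\mathrm{ri}$ the relative interior. (Here $\hat\partial f(X)$ is the set of all $\zeta$ with $\liminf_{Z\to X,\,Z\ne X}\frac{f(Z)-f(X)-\langle\zeta,Z-X\rangle}{\|Z-X\|}\ge 0$, and $\partial f(X)$ is the set of all limits of sequences $\zeta^l\in\hat\partial f(X^l)$ with $X^l\to X$ and $f(X^l)\to f(X)$; both are empty if $f(X)=\infty$.) If $\bar X$ satisfies $\partial f(\bar X)\ne\emptyset$ and $0\in\mathrm{ri}\,\partial f(\bar X)$, then $f$ satisfies the Kurdyka–Łojasiewicz property at $\bar X$ with exponent $\tfrac12$; that is, $f$ is proper and closed, and there are $c>0$, $a\in(0,\infty]$ and a neighborhood $V$ of $\bar X$ such that, with $\varphi(s)=c\,s^{1/2}$, $$\varphi'\big(f(X)-f(\bar X)\big)\cdot\mathrm{dist}\big(0,\partial f(X)\big)\ \ge\ 1\qquad\text{for all }X\in V\text{ with } f(\bar X)<f(X)<f(\bar X)+a,$$ where $\mathrm{dist}(0,\emptyset)=\infty$. -/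

import Mathlib

open Filter Topology
open scoped Matrix

/-! ### Extended-real-valued functions and their subdifferentials -/

section Subdifferential

variable {E : Type*} [NormedAddCommGroup E] [InnerProductSpace ℝ E]

/-- `h` is proper: it never takes the value `-∞` and it is finite somewhere. -/
def IsProperFun (h : E → EReal) : Prop :=
  (∀ x, h x ≠ ⊥) ∧ ∃ x, h x < ⊤

/-- A proper function is closed if it is lower semicontinuous. -/
def IsProperClosed (h : E → EReal) : Prop :=
  IsProperFun h ∧ LowerSemicontinuous h

/-- The epigraph `{(x, t) ∈ E × ℝ : h x ≤ t}`. -/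
def epi (h : E → EReal) : Set (E × ℝ) :=
  {q | h q.1 ≤ (q.2 : EReal)}

/-- The regular (Fréchet) subdifferential of a proper function; it is empty outside the domain. -/
noncomputable def regularSubdifferential (h : E → EReal) (x : E) : Set E :=
  {ζ | h x < ⊤ ∧
    0 ≤ liminf
      (fun z : E => (h z - h x - ((inner ℝ ζ (z - x) : ℝ) : EReal)) / ((‖z - x‖ : ℝ) : EReal))
      (𝓝[≠] x)}

/-- The limiting subdifferential of a proper function; it is empty outside the domain. -/
noncomputable def limitingSubdifferential (h : E → EReal) (x : E) : Set E :=
  {ζ | h x < ⊤ ∧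
    ∃ (u : ℕ → E) (ξ : ℕ → E),
      Tendsto u atTop (𝓝 x) ∧ Tendsto (fun k => h (u k)) atTop (𝓝 (h x)) ∧
      Tendsto ξ atTop (𝓝 ζ) ∧ ∀ k, ξ k ∈ regularSubdifferential h (u k)}

/-- `dom ∂h`. -/
def domSubdifferential (h : E → EReal) : Set E :=
  {x | (limitingSubdifferential h x).Nonempty}

end Subdifferential

/-! ### The Kurdyka-Łojasiewicz property -/

section KL

variable {E : Type*} [NormedAddCommGroup E] [InnerProductSpace ℝ E]

/-- `φ` is an admissible desingularizing function on `[0, a)`, where `a ∈ (0, ∞]`; only the values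
of `φ` on `[0, a)` matter. -/
structure IsDesingularizing (a : EReal) (φ : ℝ → ℝ) : Prop where
  continuousOn : ContinuousOn φ {s : ℝ | 0 ≤ s ∧ (s : EReal) < a}
  concaveOn : ConcaveOn ℝ {s : ℝ | 0 ≤ s ∧ (s : EReal) < a} φ
  nonneg : ∀ s : ℝ, 0 ≤ s → (s : EReal) < a → 0 ≤ φ s
  map_zero : φ 0 = 0
  contDiffOn : ContDiffOn ℝ 1 φ {s : ℝ | 0 < s ∧ (s : EReal) < a}
  deriv_pos : ∀ s : ℝ, 0 < s → (s : EReal) < a → 0 < deriv φ s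

/-- `h` satisfies the KL property at `x₀` with desingularizing function `φ`.  The distance of `0`
to the subdifferential is taken in `[0, ∞]`, so that it is `∞` when the subdifferential is empty. -/
def HasKLPropertyWith (h : E → EReal) (x₀ : E) (φ : ℝ → ℝ) : Prop :=
  IsProperClosed h ∧ x₀ ∈ domSubdifferential h ∧
  ∃ a : EReal, 0 < a ∧ IsDesingularizing a φ ∧
    ∃ V ∈ 𝓝 x₀, ∀ x ∈ V, h x₀ < h x → h x < h x₀ + a →
      1 ≤ ENNReal.ofReal (deriv φ (h x - h x₀).toReal) *
        Metric.infEDist 0 (limitingSubdifferential h x)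

/-- `h` satisfies the KL property at `x₀`. -/
def HasKLProperty (h : E → EReal) (x₀ : E) : Prop :=
  ∃ φ : ℝ → ℝ, HasKLPropertyWith h x₀ φ

/-- `h` satisfies the KL property at `x₀` with exponent `α ∈ [0, 1)`: the desingularizing function
can be chosen as `s ↦ c * s ^ (1 - α)` with some `c > 0`. -/
def HasKLExponent (h : E → EReal) (x₀ : E) (α : ℝ) : Prop :=
  0 ≤ α ∧ α < 1 ∧ ∃ c : ℝ, 0 < c ∧ HasKLPropertyWith h x₀ (fun s => c * s ^ (1 - α))

end KL

/-! ### Matrices, the nuclear norm, and linear matrix inequalities -/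

/-- The space of real `m × n` matrices with the trace inner product `⟪X, Y⟫ = ∑ i j, X i j * Y i j`
and the Frobenius norm; the entry in row `i` and column `j` is `X (i, j)`. -/
abbrev MatSpace (m n : ℕ) : Type := EuclideanSpace ℝ (Fin m × Fin n)

/-- The underlying matrix. -/
def MatSpace.toMatrix {m n : ℕ} (X : MatSpace m n) : Matrix (Fin m) (Fin n) ℝ :=
  Matrix.of fun i j => X (i, j)

/-- The nuclear norm: the sum of the `min m n` singular values. -/
noncomputable def nuclearNorm {m n : ℕ} (X : MatSpace m n) : ℝ :=
  ∑ k ∈ Finset.range (min m n), (Matrix.toEuclideanLin X.toMatrix).singularValues k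

/-- The affine matrix function `A₀₀ + ∑ i j, X i j • A i j + t • A₀`. -/
noncomputable def lmiPencil {m n d : ℕ} (A₀₀ A₀ : Matrix (Fin d) (Fin d) ℝ)
    (A : Fin m → Fin n → Matrix (Fin d) (Fin d) ℝ) (X : MatSpace m n) (t : ℝ) :
    Matrix (Fin d) (Fin d) ℝ :=
  A₀₀ + ∑ i, ∑ j, X (i, j) • A i j + t • A₀

/-! The function `f` is the value function of a semidefinite program: minimize `c u` subject to `M =
A₀ + 𝒜 (x, u) ⪰ 0`, where the nuclear norm enters as the least value of `(tr P + tr S) / 2` over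
positive semidefinite blocks `[P X; Xᴴ S]` (`isSDPRepresentation_nuclearSum`). Hence `f` is convex,
and its limiting subgradients satisfy the global subgradient inequality.

Let `M₀` be the matrix at an optimal `(x₀, u₀)`. A multiplier `Z ⪰ 0` with `Z * M₀ = 0` and `tr (Z 𝒜
(0, u)) = c u` represents a subgradient; it is strictly complementary if `Z + M₀ ≻ 0`. Some
subgradient `ζ` always has such a multiplier: for each `f k` rescale the projection onto the kernel
of the pencil (`exists_multiplier`), and for the nuclear norm use the polar factor of `X`
(`exists_nuclearNorm_certificate`). Since `0` is a relative interior point, `-εζ` is a subgradient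
too, and by Slater's condition it has a multiplier (`exists_dual_of_slater`). A convex combination
of the two multipliers represents `0` and is still strictly complementary.

For this `Z`, the objective gap `c u - c u₀` equals `tr (Z M)`, and `‖Z M‖² ≤ tr Z · tr M · tr (Z
M)`, so `‖Z M‖` is of the order of the square root of the gap. Near `M₀` strict complementarity
turns the conditions `M ⪰ 0`, `Z M = 0` into the linear equation `Z M = 0` alone
(`posSemidef_of_mul_eq_zero`), and distance to the solutions of a linear equation is bounded by its
residual. This is quadratic growth (`exists_quadratic_growth`), which for convex `f` gives the
exponent `1/2`. -/

/-! ### Positive semidefinite matrices -/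

namespace Matrix

section Frobenius

variable {ι κ : Type*} [Fintype ι] [Fintype κ]

attribute [local instance] Matrix.frobeniusNormedAddCommGroup Matrix.frobeniusNormedSpace

theorem frobenius_norm_sq (A : Matrix ι κ ℝ) : ‖A‖ ^ 2 = (Aᴴ * A).trace := by
  rw [frobenius_norm_def, ← Real.sqrt_eq_rpow, Real.sq_sqrt (by positivity)]
  simp only [trace, diag, mul_apply, conjTranspose_apply, star_trivial, Real.norm_eq_abs]
  rw [Finset.sum_comm]
  refine Finset.sum_congr rfl fun i _ => Finset.sum_congr rfl fun j _ => ?_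
  rw [Real.rpow_two, sq_abs, sq]

open scoped MatrixOrder Matrix.Norms.L2Operator in
theorem PosSemidef.exists_eq_conjTranspose_mul [DecidableEq ι] {M : Matrix ι ι ℝ}
    (hM : M.PosSemidef) : ∃ B : Matrix ι ι ℝ, M = Bᴴ * B := 
  CStarAlgebra.nonneg_iff_eq_star_mul_self.mp hM.nonneg

theorem PosSemidef.trace_mul_nonneg [DecidableEq ι] {Z M : Matrix ι ι ℝ} (hZ : Z.PosSemidef)
    (hM : M.PosSemidef) : 0 ≤ (Z * M).trace := by
  obtain ⟨C, rfl⟩ := hZ.exists_eq_conjTranspose_mul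
  rw [Matrix.mul_assoc, trace_mul_comm]
  exact (hM.mul_mul_conjTranspose_same C).trace_nonneg

/-- The product of two positive semidefinite matrices is controlled by their inner product. -/
theorem PosSemidef.norm_mul_sq_le [DecidableEq ι] {Z M : Matrix ι ι ℝ} (hZ : Z.PosSemidef)
    (hM : M.PosSemidef) : ‖Z * M‖ ^ 2 ≤ Z.trace * M.trace * (Z * M).trace := by
  obtain ⟨C, rfl⟩ := hZ.exists_eq_conjTranspose_mul
  obtain ⟨B, rfl⟩ := hM.exists_eq_conjTranspose_mul
  -- With `Z = CᴴC` and `M = BᴴB` all three traces are squared Frobenius norms, and the bound is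
  -- submultiplicativity for `Cᴴ (C Bᴴ) B`.
  have h1 : (Cᴴ * C * (Bᴴ * B)).trace = ‖C * Bᴴ‖ ^ 2 := by
    rw [frobenius_norm_sq, conjTranspose_mul, conjTranspose_conjTranspose, Matrix.mul_assoc,
      ← Matrix.mul_assoc C, trace_mul_comm, Matrix.mul_assoc, trace_mul_comm]
  have h2 : ‖Cᴴ * C * (Bᴴ * B)‖ ≤ ‖C‖ * ‖C * Bᴴ‖ * ‖B‖ := by
    have : Cᴴ * C * (Bᴴ * B) = Cᴴ * (C * Bᴴ) * B := by simp only [Matrix.mul_assoc]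
    rw [this, ← frobenius_norm_conjTranspose C]
    refine (frobenius_norm_mul _ _).trans ?_
    gcongr
    exact frobenius_norm_mul _ _
  rw [h1, ← frobenius_norm_sq, ← frobenius_norm_sq]
  calc _ ≤ (‖C‖ * ‖C * Bᴴ‖ * ‖B‖) ^ 2 := by gcongr
    _ = _ := by ring

theorem PosSemidef.mul_eq_zero_of_trace_mul_eq_zero [DecidableEq ι] {Z M : Matrix ι ι ℝ}
    (hZ : Z.PosSemidef) (hM : M.PosSemidef) (h : (Z * M).trace = 0) : Z * M = 0 := by
  have := hZ.norm_mul_sq_le hM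
  rw [h, mul_zero] at this
  exact norm_eq_zero.mp (pow_eq_zero_iff (two_ne_zero) |>.mp (le_antisymm this (by positivity)))

end Frobenius

variable {ι : Type*} [Fintype ι]

theorem posSemidef_real_iff {M : Matrix ι ι ℝ} :
    M.PosSemidef ↔ M.IsHermitian ∧ ∀ x, 0 ≤ x ⬝ᵥ (M *ᵥ x) := by
  simpa using posSemidef_iff_dotProduct_mulVec (M := M)

theorem posDef_real_iff {M : Matrix ι ι ℝ} :
    M.PosDef ↔ M.IsHermitian ∧ ∀ x, x ≠ 0 → 0 < x ⬝ᵥ (M *ᵥ x) := by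
  simpa using posDef_iff_dotProduct_mulVec (M := M)

/-- A symmetric matrix that becomes positive definite after adding a matrix orthogonal to it is
positive semidefinite. -/
theorem posSemidef_of_mul_eq_zero [DecidableEq ι] {Z M : Matrix ι ι ℝ} (hZ : Z.IsHermitian)
    (hM : M.IsHermitian) (h : Z * M = 0) (hpd : (Z + M).PosDef) : M.PosSemidef := by
  have hu := hpd.isUnit
  rw [Matrix.isUnit_iff_isUnit_det] at hu
  have h' : M * Z = 0 := by
    have := congrArg conjTranspose h
    rwa [conjTranspose_mul, hZ.eq, hM.eq, conjTranspose_zero] at this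
  -- Since `M² = (Z + M) M` and `M` commutes with `Z + M`, it follows that `M = M (Z + M)⁻¹ M`, a
  -- congruence of a positive definite matrix.
  have e2 : (Z + M)⁻¹ * (M * M) = M := by
    have : M * M = (Z + M) * M := by rw [Matrix.add_mul, h, zero_add]
    rw [this, ← Matrix.mul_assoc, nonsing_inv_mul _ hu, Matrix.one_mul]
  have e3 : M * (Z + M)⁻¹ = (Z + M)⁻¹ * M := by
    have : (Z + M) * M = M * (Z + M) := by rw [Matrix.add_mul, h, Matrix.mul_add, h']
    calc M * (Z + M)⁻¹ = (Z + M)⁻¹ * ((Z + M) * M) * (Z + M)⁻¹ := by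
          rw [← Matrix.mul_assoc, nonsing_inv_mul _ hu, Matrix.one_mul]
      _ = _ := by
          rw [this, Matrix.mul_assoc, Matrix.mul_assoc, mul_nonsing_inv _ hu, Matrix.mul_one]
  have e4 : M = M * (Z + M)⁻¹ * Mᴴ := by
    rw [hM.eq, e3, Matrix.mul_assoc, e2]
  rw [e4]
  exact hpd.inv.posSemidef.mul_mul_conjTranspose_same M

/-- By homogeneity positivity need only be tested on the compact unit sphere. Symmetry is left out
so that the set is open in the space of all matrices. -/
theorem isOpen_setOf_forall_dotProduct_mulVec_pos :
    IsOpen {S : Matrix ι ι ℝ | ∀ x, x ≠ 0 → 0 < x ⬝ᵥ (S *ᵥ x)} := by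
  have key : {S : Matrix ι ι ℝ | ∀ x, x ≠ 0 → 0 < x ⬝ᵥ (S *ᵥ x)} =
      {S : Matrix ι ι ℝ | ∀ x ∈ Metric.sphere (0 : ι → ℝ) 1, 0 < x ⬝ᵥ (S *ᵥ x)} := by
    ext S
    refine ⟨fun h x hx => h x ?_, fun h x hx => ?_⟩
    · rintro rfl
      simp at hx
    · have hn : 0 < ‖x‖ := norm_pos_iff.mpr hx
      have := h (‖x‖⁻¹ • x) (by simp [norm_smul, hn.ne'])
      simp only [mulVec_smul, smul_dotProduct, dotProduct_smul, smul_eq_mul] at this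
      have h2 := (mul_pos_iff_of_pos_left (inv_pos.mpr hn)).mp this
      exact (mul_pos_iff_of_pos_left (inv_pos.mpr hn)).mp h2
  rw [key, isOpen_iff_mem_nhds]
  intro S hS
  refine (isCompact_sphere (0 : ι → ℝ) 1).eventually_forall_of_forall_eventually
    (P := fun S x => 0 < x ⬝ᵥ (S *ᵥ x)) fun x hx => ?_
  have hc : Continuous fun q : Matrix ι ι ℝ × (ι → ℝ) => q.2 ⬝ᵥ (q.1 *ᵥ q.2) := by fun_prop
  exact hc.continuousAt.eventually (lt_mem_nhds (hS x hx))

section BlockDiagonal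

variable {o : Type*} [DecidableEq o] {d : o → Type*}

theorem isHermitian_blockDiagonal' {M : ∀ k, Matrix (d k) (d k) ℝ}
    (h : ∀ k, (M k).IsHermitian) : (blockDiagonal' M).IsHermitian := by
  rw [IsHermitian, blockDiagonal'_conjTranspose]
  congr 1
  funext k
  exact h k

variable [Fintype o] [∀ k, Fintype (d k)]

theorem dotProduct_blockDiagonal'_mulVec (M : ∀ k, Matrix (d k) (d k) ℝ) (x : (Σ k, d k) → ℝ) :
    x ⬝ᵥ (blockDiagonal' M *ᵥ x) = ∑ k, (fun i => x ⟨k, i⟩) ⬝ᵥ (M k *ᵥ fun i => x ⟨k, i⟩) := by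
  simp only [dotProduct, mulVec, Fintype.sum_sigma]
  refine Finset.sum_congr rfl fun k _ => Finset.sum_congr rfl fun i _ => ?_
  congr 1
  rw [Finset.sum_eq_single k]
  · simp [blockDiagonal'_apply_eq]
  · intro k' _ hk
    refine Finset.sum_eq_zero fun j _ => ?_
    rw [blockDiagonal'_apply_ne _ _ _ hk.symm, zero_mul]
  · simp

theorem posSemidef_blockDiagonal'_iff {M : ∀ k, Matrix (d k) (d k) ℝ} :
    (blockDiagonal' M).PosSemidef ↔ ∀ k, (M k).PosSemidef := by
  refine ⟨fun h k => ?_, fun h => ?_⟩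
  · have : M k = (blockDiagonal' M).submatrix (Sigma.mk k) (Sigma.mk k) := by
      ext i j
      simp [blockDiagonal'_apply_eq]
    rw [this]
    exact h.submatrix _
  · refine posSemidef_real_iff.mpr ⟨isHermitian_blockDiagonal' fun k => (h k).isHermitian,
      fun x => ?_⟩
    rw [dotProduct_blockDiagonal'_mulVec]
    exact Finset.sum_nonneg fun k _ => (posSemidef_real_iff.mp (h k)).2 _

theorem PosDef.blockDiagonal' {M : ∀ k, Matrix (d k) (d k) ℝ} (h : ∀ k, (M k).PosDef) :
    (Matrix.blockDiagonal' M).PosDef := by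
  refine posDef_real_iff.mpr ⟨isHermitian_blockDiagonal' fun k => (h k).isHermitian,
    fun x hx => ?_⟩
  rw [dotProduct_blockDiagonal'_mulVec]
  obtain ⟨⟨k, i⟩, hki⟩ := Function.ne_iff.mp hx
  refine Finset.sum_pos' (fun k _ => (posSemidef_real_iff.mp (h k).posSemidef).2 _)
    ⟨k, Finset.mem_univ _, (posDef_real_iff.mp (h k)).2 _ ?_⟩
  exact Function.ne_iff.mpr ⟨i, hki⟩

end BlockDiagonal

end Matrix

/-! ### Subgradients of convex functions -/

section ConvexSubgradient

variable {E : Type*} [NormedAddCommGroup E] [InnerProductSpace ℝ E]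

/-- `h` is convex: its epigraph is a convex set. -/
def IsConvexFun (h : E → EReal) : Prop :=
  Convex ℝ (epi h)

theorem mem_regularSubdifferential_of_le {h : E → EReal} {x ζ : E} (hbot : h x ≠ ⊥)
    (hx : h x < ⊤) (H : ∀ z, h x + ((inner ℝ ζ (z - x) : ℝ) : EReal) ≤ h z) :
    ζ ∈ regularSubdifferential h x := by
  refine ⟨hx, le_liminf_of_le (by isBoundedDefault) (Eventually.of_forall fun z => ?_)⟩
  refine EReal.div_nonneg ?_ (by exact_mod_cast norm_nonneg _)
  have := H z
  lift h x to ℝ using ⟨hx.ne, hbot⟩ with a ha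
  induction hz : h z with
  | bot => rw [hz, ← EReal.coe_add] at this; simp at this
  | top => simp
  | coe b =>
    rw [hz] at this
    norm_cast at this ⊢
    linarith

theorem mem_limitingSubdifferential_of_le {h : E → EReal} {x ζ : E} (hbot : h x ≠ ⊥)
    (hx : h x < ⊤) (H : ∀ z, h x + ((inner ℝ ζ (z - x) : ℝ) : EReal) ≤ h z) :
    ζ ∈ limitingSubdifferential h x :=
  ⟨hx, fun _ => x, fun _ => ζ, tendsto_const_nhds, tendsto_const_nhds, tendsto_const_nhds,
    fun _ => mem_regularSubdifferential_of_le hbot hx H⟩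

/-- On a segment from `x`, convexity bounds every difference quotient by the slope of the chord, so
the local condition at `x` becomes global. The real bound `b` on `h z` avoids subtraction of
infinite values. -/
theorem le_sub_inner_of_mem_regularSubdifferential {h : E → EReal} (hc : IsConvexFun h)
    (hbot : ∀ x, h x ≠ ⊥) {x ζ : E} (hζ : ζ ∈ regularSubdifferential h x) {z : E} {b : ℝ}
    (hz : h z ≤ b) : h x ≤ ((b - inner ℝ ζ (z - x) : ℝ) : EReal) := by
  obtain ⟨hx, hlim⟩ := hζ
  rcases eq_or_ne z x with rfl | hne
  · simpa using hz
  obtain ⟨a, ha⟩ : ∃ a : ℝ, h x = a :=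
    ⟨(h x).toReal, (EReal.coe_toReal hx.ne (hbot x)).symm⟩
  rw [ha]
  have hn : 0 < ‖z - x‖ := norm_pos_iff.mpr (sub_ne_zero.mpr hne)
  set q : ℝ := (b - a - inner ℝ ζ (z - x)) / ‖z - x‖ with hq
  have hpath : Tendsto (fun s : ℝ => x + s • (z - x)) (𝓝[>] 0) (𝓝[≠] x) := by
    refine tendsto_nhdsWithin_iff.mpr ⟨?_, ?_⟩
    · have : Continuous fun s : ℝ => x + s • (z - x) := by fun_prop
      have h0 := this.tendsto 0
      simp only [zero_smul, add_zero] at h0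
      exact h0.mono_left nhdsWithin_le_nhds
    · filter_upwards [self_mem_nhdsWithin] with s hs
      have : s ≠ 0 := ne_of_gt hs
      simpa [this, sub_eq_zero] using hne
  -- `q` dominates the quotient at every point of the open segment, and near `x` this quotient
  -- exceeds any `c < 0`.
  have hq0 : ∀ c : ℝ, c < 0 → c ≤ q := by
    intro c hc0
    have hev := eventually_lt_of_lt_liminf
      (lt_of_lt_of_le (show ((c : ℝ) : EReal) < 0 by exact_mod_cast hc0) hlim)
    have h1 := hpath.eventually hev
    have h2 : ∀ᶠ s : ℝ in 𝓝[>] 0, s ∈ Set.Ioo (0 : ℝ) 1 := Ioo_mem_nhdsGT one_pos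
    obtain ⟨s, hs, hs0, hs1⟩ := (h1.and h2).exists
    have hmem := hc (x := (x, a)) (y := (z, b)) (by simp [epi, ha]) (by simpa [epi] using hz)
      (sub_nonneg.mpr hs1.le) hs0.le (by ring : 1 - s + s = 1)
    have hval : h (x + s • (z - x)) ≤ ((a + s * (b - a) : ℝ) : EReal) := by
      have e1 : x + s • (z - x) = (1 - s) • x + s • z := by module
      have e2 : a + s * (b - a) = (1 - s) * a + s * b := by ring
      rw [e1, e2]
      simpa [epi] using hmem
    obtain ⟨v, hv⟩ : ∃ v : ℝ, h (x + s • (z - x)) = v :=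
      ⟨_, (EReal.coe_toReal (lt_of_le_of_lt hval (EReal.coe_lt_top _)).ne (hbot _)).symm⟩
    rw [hv] at hval hs
    rw [ha] at hs
    simp only [add_sub_cancel_left, inner_smul_right, norm_smul, Real.norm_eq_abs,
      abs_of_pos hs0] at hs
    norm_cast at hs hval
    rw [← EReal.coe_div, EReal.coe_lt_coe_iff] at hs
    rw [hq, le_div_iff₀ hn]
    rw [lt_div_iff₀ (by positivity)] at hs
    have : s * (c * ‖z - x‖) ≤ s * (b - a - inner ℝ ζ (z - x)) := by nlinarith
    exact le_of_mul_le_mul_left this hs0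
  have hq1 : 0 ≤ q := le_of_forall_lt fun c hc0 => by
    have := hq0 (c / 2) (by linarith)
    linarith
  have : 0 ≤ b - a - inner ℝ ζ (z - x) := by
    have := mul_nonneg hq1 hn.le
    rwa [hq, div_mul_cancel₀ _ hn.ne'] at this
  exact_mod_cast (by linarith : a ≤ b - inner ℝ ζ (z - x))

theorem le_sub_inner_of_mem_limitingSubdifferential {h : E → EReal} (hc : IsConvexFun h)
    (hbot : ∀ x, h x ≠ ⊥) {x ζ : E} (hζ : ζ ∈ limitingSubdifferential h x) {z : E} {b : ℝ}
    (hz : h z ≤ b) : h x ≤ ((b - inner ℝ ζ (z - x) : ℝ) : EReal) := by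
  obtain ⟨-, u, ξ, hu, hhu, hξ, hreg⟩ := hζ
  refine le_of_tendsto_of_tendsto' hhu ?_ fun k =>
    le_sub_inner_of_mem_regularSubdifferential hc hbot (hreg k) hz
  exact (continuous_coe_real_ereal.tendsto _).comp
    (tendsto_const_nhds.sub (hξ.inner (tendsto_const_nhds.sub hu)))

end ConvexSubgradient

/-! ### Duality and strict complementarity for semidefinite programs -/

section Duality

variable {ι : Type*} [Fintype ι] [DecidableEq ι]

theorem Matrix.exists_eq_trace_mul (φ : Matrix ι ι ℝ →ₗ[ℝ] ℝ) :
    ∃ W : Matrix ι ι ℝ, ∀ S, φ S = (W * S).trace := by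
  refine ⟨Matrix.of fun j i => φ (Matrix.single i j 1), fun S => ?_⟩
  conv_lhs => rw [Matrix.matrix_eq_sum_single S]
  simp only [map_sum, Matrix.trace, Matrix.diag, Matrix.mul_apply, Matrix.of_apply]
  rw [Finset.sum_comm]
  refine Finset.sum_congr rfl fun j _ => Finset.sum_congr rfl fun i _ => ?_
  have : Matrix.single i j (S i j) = S i j • Matrix.single i j (1 : ℝ) := by
    rw [Matrix.smul_single, smul_eq_mul, mul_one]
  rw [this, map_smul, smul_eq_mul, mul_comm]

/-- The antisymmetric part of a representing matrix has zero trace pairing with symmetric matrices,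
so it can be dropped. -/
theorem Matrix.exists_isHermitian_eq_trace_mul (φ : Matrix ι ι ℝ →ₗ[ℝ] ℝ) :
    ∃ W : Matrix ι ι ℝ, W.IsHermitian ∧ ∀ S, S.IsHermitian → φ S = (W * S).trace := by
  obtain ⟨W, hW⟩ := Matrix.exists_eq_trace_mul φ
  refine ⟨(1 / 2 : ℝ) • (W + Wᴴ), ?_, fun S hS => ?_⟩
  · rw [Matrix.IsHermitian, Matrix.conjTranspose_smul, Matrix.conjTranspose_add,
      Matrix.conjTranspose_conjTranspose, add_comm Wᴴ, star_trivial]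
  · have : (Wᴴ * S).trace = (W * S).trace := by
      conv_lhs => rw [← hS.eq, ← Matrix.conjTranspose_mul, Matrix.trace_conjTranspose,
        star_trivial, Matrix.trace_mul_comm]
    rw [hW, Matrix.smul_mul, Matrix.trace_smul, Matrix.add_mul, Matrix.trace_add, this,
      smul_eq_mul]
    ring

theorem eq_zero_of_forall_le_add_mul {a b u : ℝ} (h : ∀ t : ℝ, u ≤ a + t * b) : b = 0 := by
  by_contra hb
  have := h ((u - a - 1) / b)
  rw [div_mul_cancel₀ _ hb] at this
  linarith

theorem nonpos_of_forall_le_add_mul {a b : ℝ} (h : ∀ t : ℝ, 0 < t → a + t * b ≤ 0) : a ≤ 0 := by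
  by_contra! ha
  have h1 := h (a / (2 * (|b| + 1))) (by positivity)
  have h2 : a / (2 * (|b| + 1)) * b ≥ -(a / 2) := by
    have : a / (2 * (|b| + 1)) * (|b| + 1) = a / 2 := by field_simp
    have h3 : 0 < a / (2 * (|b| + 1)) := by positivity
    have h4 := neg_abs_le b
    nlinarith
  linarith

/-- Strong duality with attainment for a semidefinite program satisfying Slater's condition. -/
theorem exists_dual_of_slater {Y : Type*} [AddCommGroup Y] [Module ℝ Y] {A₀ : Matrix ι ι ℝ}
    {𝒜 : Y →ₗ[ℝ] Matrix ι ι ℝ} (hA₀ : A₀.IsHermitian) (hA : ∀ y, (𝒜 y).IsHermitian)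
    (ℓ : Y →ₗ[ℝ] ℝ) {w y₀ : Y} (hw : (A₀ + 𝒜 w).PosDef) (hy₀ : (A₀ + 𝒜 y₀).PosSemidef)
    (hmin : ∀ y, (A₀ + 𝒜 y).PosSemidef → ℓ y₀ ≤ ℓ y) :
    ∃ Z : Matrix ι ι ℝ, Z.PosSemidef ∧ Z * (A₀ + 𝒜 y₀) = 0 ∧ ∀ y, (Z * 𝒜 y).trace = ℓ y := by
  -- A point common to `O` and `T` would be feasible with a value below the minimum; the multiplier
  -- comes from a hyperplane separating the two.
  set O : Set (Matrix ι ι ℝ × ℝ) := {q | (∀ x, x ≠ 0 → 0 < x ⬝ᵥ (q.1 *ᵥ x)) ∧ q.2 < 0}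
  set T : Set (Matrix ι ι ℝ × ℝ) := Set.range fun y => (A₀ + 𝒜 y, ℓ y - ℓ y₀)
  have hOopen : IsOpen O :=
    (Matrix.isOpen_setOf_forall_dotProduct_mulVec_pos.preimage continuous_fst).inter
      (isOpen_Iio.preimage continuous_snd)
  have hOconv : Convex ℝ O := by
    refine convex_iff_forall_pos.mpr fun q hq r hr a b ha hb _ => ⟨fun x hx => ?_, ?_⟩
    · have h1 := mul_pos ha (hq.1 x hx)
      have h2 := mul_pos hb (hr.1 x hx)
      simp only [Prod.fst_add, Prod.smul_fst, Matrix.add_mulVec, Matrix.smul_mulVec,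
        dotProduct_add, dotProduct_smul, smul_eq_mul]
      exact add_pos h1 h2
    · have h1 := mul_neg_of_pos_of_neg ha hq.2
      have h2 := mul_neg_of_pos_of_neg hb hr.2
      simp only [Prod.snd_add, Prod.smul_snd, smul_eq_mul]
      exact add_neg h1 h2
  have hTconv : Convex ℝ T := by
    rintro _ ⟨y, rfl⟩ _ ⟨z, rfl⟩ a b - - hab
    refine ⟨a • y + b • z, Prod.ext ?_ ?_⟩
    · have : A₀ = a • A₀ + b • A₀ := by rw [← add_smul, hab, one_smul]
      simp only [map_add, map_smul, Prod.fst_add, Prod.smul_fst, smul_add]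
      conv_lhs => rw [this]
      abel
    · have : ℓ y₀ = a * ℓ y₀ + b * ℓ y₀ := by rw [← add_mul, hab, one_mul]
      simp only [map_add, map_smul, Prod.snd_add, Prod.smul_snd, smul_eq_mul]
      linarith
  have hherm : ∀ y, (A₀ + 𝒜 y).IsHermitian := fun y => hA₀.add (hA y)
  have hdisj : Disjoint O T := by
    rw [Set.disjoint_left]
    rintro _ hq ⟨y, rfl⟩
    have := hmin y (Matrix.posDef_real_iff.mpr ⟨hherm y, hq.1⟩).posSemidef
    have := hq.2
    simp only at this
    linarith
  obtain ⟨φ, u, hφO, hφT⟩ := geometric_hahn_banach_open hOconv hOopen hTconv hdisj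
  have hsplit : ∀ S r, φ (S, r) = φ (S, 0) + r * φ (0, 1) := by
    intro S r
    have : (S, r) = (S, (0 : ℝ)) + r • ((0 : Matrix ι ι ℝ), (1 : ℝ)) := by simp
    rw [this, map_add, map_smul, smul_eq_mul]
  have hadd : ∀ S S', φ (S + S', 0) = φ (S, 0) + φ (S', 0) := by
    intro S S'
    rw [← map_add]; simp
  have hsmul : ∀ (t : ℝ) S, φ (t • S, 0) = t * φ (S, 0) := by
    intro t S
    rw [← smul_eq_mul, ← map_smul]; simp
  -- The functional is bounded below on the affine set `T`, so it is constant there.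
  have hlin : ∀ y, φ (𝒜 y, 0) + ℓ y * φ (0, 1) = 0 := by
    intro y
    refine eq_zero_of_forall_le_add_mul (a := φ (A₀ + 𝒜 y₀, 0)) (u := u) fun t => ?_
    have := hφT _ ⟨y₀ + t • y, rfl⟩
    simp only [map_add, map_smul, ← add_assoc] at this
    rw [hsplit, hadd, hsmul, smul_eq_mul] at this
    linarith
  have hu : u ≤ φ (A₀ + 𝒜 y₀, 0) := by simpa using hφT _ ⟨y₀, rfl⟩
  have hcone : ∀ q ∈ O, ∀ t : ℝ, 0 < t → t * φ q < u := by
    intro q hq t ht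
    rw [← smul_eq_mul, ← map_smul]
    refine hφO _ ⟨fun x hx => ?_, ?_⟩
    · simp only [Prod.smul_fst, Matrix.smul_mulVec, dotProduct_smul, smul_eq_mul]
      exact mul_pos ht (hq.1 x hx)
    · exact mul_neg_of_pos_of_neg ht hq.2
  have hOnonpos : ∀ q ∈ O, φ q ≤ 0 := by
    intro q hq
    by_contra! hpos
    have := hcone q hq ((|u| + 1) / φ q) (by positivity)
    rw [div_mul_cancel₀ _ hpos.ne'] at this
    linarith [le_abs_self u]
  -- Adding `t • (1, -1)` moves `(S, r)` into `O`; let `t` tend to `0`.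
  have hclos : ∀ S : Matrix ι ι ℝ, S.PosSemidef → ∀ r ≤ (0 : ℝ), φ (S, r) ≤ 0 := by
    intro S hS r hr
    refine nonpos_of_forall_le_add_mul (b := φ (1, -1)) fun t ht => ?_
    rw [← smul_eq_mul, ← map_smul, ← map_add]
    refine hOnonpos _ ⟨fun x hx => ?_, ?_⟩
    · exact (Matrix.posDef_real_iff.mp (Matrix.PosDef.posSemidef_add hS (Matrix.PosDef.one.smul ht))).2 x hx
    · simp only [Prod.snd_add, Prod.smul_snd, smul_eq_mul]
      linarith
  have hP : φ (A₀ + 𝒜 y₀, 0) ≤ 0 := hclos _ hy₀ 0 le_rfl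
  have hWO : (A₀ + 𝒜 w, (-1 : ℝ)) ∈ O := ⟨(Matrix.posDef_real_iff.mp hw).2, by simp⟩
  have hu0 : 0 ≤ u := by
    by_contra! hneg
    have h0 := hOnonpos _ hWO
    have h1 := hcone _ hWO (-u / (2 * (|φ (A₀ + 𝒜 w, -1)| + 1)))
      (div_pos (by linarith) (by positivity))
    have h2 : -u / (2 * (|φ (A₀ + 𝒜 w, -1)| + 1)) * (|φ (A₀ + 𝒜 w, -1)| + 1) = -u / 2 := by
      field_simp
    have h3 : 0 < -u / (2 * (|φ (A₀ + 𝒜 w, -1)| + 1)) := div_pos (by linarith) (by positivity)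
    rw [abs_of_nonpos h0] at h1 h2 h3
    nlinarith
  have hu00 : u = 0 := by linarith
  have hP0 : φ (A₀ + 𝒜 y₀, 0) = 0 := by linarith
  have hμ0 : 0 ≤ φ (0, 1) := by
    have := hclos 0 Matrix.PosSemidef.zero (-1) (by norm_num)
    rw [hsplit] at this
    have h0 : φ (0, 0) = 0 := map_zero φ
    linarith
  have hw1 : φ (A₀ + 𝒜 w, 0) + (ℓ w - ℓ y₀) * φ (0, 1) = 0 := by
    have h1 := hlin w
    have h2 := hlin y₀
    rw [hadd] at hP0 ⊢
    linarith
  -- If `φ (0, 1)` were `0`, `φ` would vanish at the Slater point paired with `-1`, which lies in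
  -- `O`, where `φ < u = 0`. Division by `φ (0, 1)` then normalizes the multiplier.
  have hμ : 0 < φ (0, 1) := by
    refine lt_of_le_of_ne hμ0 fun h => ?_
    have h1 := hφO _ hWO
    rw [hsplit, ← h] at h1
    rw [← h] at hw1
    linarith
  obtain ⟨W, hWh, hW⟩ := Matrix.exists_isHermitian_eq_trace_mul
    (φ.toLinearMap ∘ₗ LinearMap.inl ℝ (Matrix ι ι ℝ) ℝ)
  simp only [LinearMap.coe_comp, ContinuousLinearMap.coe_coe, Function.comp_apply,
    LinearMap.inl_apply] at hW
  have hZ : ∀ S : Matrix ι ι ℝ, S.IsHermitian →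
      ((-(φ (0, 1))⁻¹) • W * S).trace = -(φ (0, 1))⁻¹ * φ (S, 0) := by
    intro S hS
    rw [Matrix.smul_mul, Matrix.trace_smul, ← hW S hS, smul_eq_mul]
  have hpsd : ((-(φ (0, 1))⁻¹) • W).PosSemidef := by
    refine Matrix.posSemidef_real_iff.mpr ⟨?_, fun x => ?_⟩
    · rw [Matrix.IsHermitian, Matrix.conjTranspose_smul, hWh.eq, star_trivial]
    · have hx := Matrix.posSemidef_vecMulVec_self_star x
      have h1 := hZ _ hx.isHermitian
      have h2 := hclos _ hx 0 le_rfl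
      rw [star_trivial] at h1 h2
      rw [Matrix.mul_vecMulVec, Matrix.trace_vecMulVec, dotProduct_comm] at h1
      rw [h1]
      have := inv_pos.mpr hμ
      nlinarith
  refine ⟨_, hpsd, hpsd.mul_eq_zero_of_trace_mul_eq_zero hy₀ ?_, fun y => ?_⟩
  · rw [hZ _ (hherm _), hP0, mul_zero]
  · rw [hZ _ (hA y)]
    have := hlin y
    rw [eq_neg_of_add_eq_zero_left this]
    field_simp

end Duality

/-! ### Semidefinite representable functions -/

/-- The line through `0` and `ζ` lies in the affine span, and `0` has a neighbourhood in that span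
contained in `S`. -/
theorem exists_neg_smul_mem_of_zero_mem_intrinsicInterior {E : Type*} [NormedAddCommGroup E]
    [NormedSpace ℝ E] {S : Set E} {ζ : E} (h0 : (0 : E) ∈ intrinsicInterior ℝ S) (hζ : ζ ∈ S) :
    ∃ ε : ℝ, 0 < ε ∧ -(ε • ζ) ∈ S := by
  obtain ⟨y, hy, hy0⟩ := mem_intrinsicInterior.mp h0
  have hmem : ∀ t : ℝ, -(t • ζ) ∈ affineSpan ℝ S := by
    intro t
    have := AffineMap.lineMap_mem (-t) (subset_affineSpan ℝ S (intrinsicInterior_subset h0))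
      (subset_affineSpan ℝ S hζ)
    simpa [AffineMap.lineMap_apply] using this
  have hcont : Continuous fun t : ℝ => (⟨-(t • ζ), hmem t⟩ : affineSpan ℝ S) := by
    refine Continuous.subtype_mk (by fun_prop) _
  have h1 : (⟨-((0 : ℝ) • ζ), hmem 0⟩ : affineSpan ℝ S) = y := by
    ext
    simp [hy0]
  have h2 : ∀ᶠ t : ℝ in 𝓝 0, -(t • ζ) ∈ S :=
    hcont.continuousAt (h1 ▸ mem_interior_iff_mem_nhds.mp hy)
  have h3 : ∀ᶠ t : ℝ in 𝓝[>] 0, 0 < t := self_mem_nhdsWithin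
  obtain ⟨t, ht, ht0⟩ := ((h2.filter_mono nhdsWithin_le_nhds).and h3).exists
  exact ⟨t, ht0, ht⟩

/-- An error bound for linear equations: `v - w` is in the kernel of `T`, at distance at most `C *
‖T v‖` from `v`. It is the open mapping theorem for `T` onto its range. -/
theorem LinearMap.exists_mem_ker_norm_sub_le {V G : Type*} [NormedAddCommGroup V]
    [NormedSpace ℝ V] [FiniteDimensional ℝ V] [NormedAddCommGroup G] [NormedSpace ℝ G]
    [FiniteDimensional ℝ G] (T : V →ₗ[ℝ] G) :
    ∃ C : ℝ, 0 < C ∧ ∀ v, ∃ w, T w = T v ∧ ‖w‖ ≤ C * ‖T v‖ := by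
  have hs : Function.Surjective (LinearMap.toContinuousLinearMap T.rangeRestrict) :=
    T.surjective_rangeRestrict
  obtain ⟨C, hC, h⟩ := ContinuousLinearMap.exists_preimage_norm_le _ hs
  refine ⟨C, hC, fun v => ?_⟩
  obtain ⟨w, hw, hn⟩ := h (T.rangeRestrict v)
  exact ⟨w, congrArg Subtype.val hw, hn⟩

section SDP

variable {E F ι : Type*} [NormedAddCommGroup E] [InnerProductSpace ℝ E]
  [NormedAddCommGroup F] [NormedSpace ℝ F]

/-- `f x` is the optimal value, attained when it is finite, of the semidefinite program of
minimizing `c u` subject to `A₀ + 𝒜 (x, u) ⪰ 0`. -/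
structure IsSDPRepresentation (f : E → EReal) (A₀ : Matrix ι ι ℝ)
    (𝒜 : E × F →ₗ[ℝ] Matrix ι ι ℝ) (c : F →ₗ[ℝ] ℝ) : Prop where
  isHermitian_const : A₀.IsHermitian
  isHermitian_map : ∀ y, (𝒜 y).IsHermitian
  ne_bot : ∀ x, f x ≠ ⊥
  le_iff : ∀ (x : E) (τ : ℝ), f x ≤ τ ↔ ∃ u, (A₀ + 𝒜 (x, u)).PosSemidef ∧ c u ≤ τ

variable {f : E → EReal} {A₀ : Matrix ι ι ℝ} {𝒜 : E × F →ₗ[ℝ] Matrix ι ι ℝ} {c : F →ₗ[ℝ] ℝ}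

theorem IsSDPRepresentation.isConvexFun (hf : IsSDPRepresentation f A₀ 𝒜 c) :
    IsConvexFun f := by
  rintro ⟨x, r⟩ hx ⟨y, s⟩ hy a b ha hb hab
  obtain ⟨u, hu, hcu⟩ := (hf.le_iff x r).mp hx
  obtain ⟨v, hv, hcv⟩ := (hf.le_iff y s).mp hy
  refine (hf.le_iff _ _).mpr ⟨a • u + b • v, ?_, ?_⟩
  · have : A₀ + 𝒜 (a • x + b • y, a • u + b • v) =
        a • (A₀ + 𝒜 (x, u)) + b • (A₀ + 𝒜 (y, v)) := by
      have e : (a • x + b • y, a • u + b • v) = a • (x, u) + b • (y, v) := rfl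
      have h1 : A₀ = a • A₀ + b • A₀ := by rw [← add_smul, hab, one_smul]
      rw [e, map_add, map_smul, map_smul, smul_add, smul_add]
      conv_lhs => rw [h1]
      abel
    simp only [Prod.smul_mk, Prod.mk_add_mk]
    rw [this]
    exact (hu.smul ha).add (hv.smul hb)
  · simp only [Prod.smul_mk, Prod.mk_add_mk, map_add, map_smul, smul_eq_mul]
    gcongr

variable [Fintype ι]

/-- The value at `x₀` is attained at `u₀`, and the multiplier `Z` is strictly complementary to the
matrix at `(x₀, u₀)`. -/
structure IsStrictlyComplementary (A₀ : Matrix ι ι ℝ) (𝒜 : E × F →ₗ[ℝ] Matrix ι ι ℝ)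
    (c : F →ₗ[ℝ] ℝ) (x₀ : E) (u₀ : F) (Z : Matrix ι ι ℝ) : Prop where
  primal : (A₀ + 𝒜 (x₀, u₀)).PosSemidef
  dual : Z.PosSemidef
  mul_eq_zero : Z * (A₀ + 𝒜 (x₀, u₀)) = 0
  posDef : (Z + (A₀ + 𝒜 (x₀, u₀))).PosDef
  trace_mul : ∀ u, (Z * 𝒜 (0, u)).trace = c u

/-- When `Z` represents the zero subgradient the first term on the right vanishes, and the
complementarity gap is the objective gap. -/
theorem IsStrictlyComplementary.trace_mul_eq {x₀ : E} {u₀ : F} {Z : Matrix ι ι ℝ}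
    (hZ : IsStrictlyComplementary A₀ 𝒜 c x₀ u₀ Z) (x : E) (u : F) :
    (Z * (A₀ + 𝒜 (x, u))).trace = (Z * 𝒜 (x - x₀, 0)).trace + (c u - c u₀) := by
  have h1 : A₀ + 𝒜 (x, u) = (A₀ + 𝒜 (x₀, u₀)) + (𝒜 (x - x₀, 0) + 𝒜 (0, u - u₀)) := by
    rw [← map_add, add_assoc, ← map_add]
    simp
  rw [h1, Matrix.mul_add, hZ.mul_eq_zero, zero_add, Matrix.mul_add, Matrix.trace_add,
    hZ.trace_mul, map_sub]

variable [FiniteDimensional ℝ E] [DecidableEq ι]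

theorem exists_inner_eq_trace_mul (Z : Matrix ι ι ℝ) (𝒜 : E × F →ₗ[ℝ] Matrix ι ι ℝ) :
    ∃ ζ : E, ∀ x, inner ℝ ζ x = -(Z * 𝒜 (x, 0)).trace := by
  let ψ : E →ₗ[ℝ] ℝ :=
    -(Matrix.traceLinearMap ι ℝ ℝ ∘ₗ LinearMap.mulLeft ℝ Z ∘ₗ 𝒜 ∘ₗ LinearMap.inl ℝ E F)
  refine ⟨(InnerProductSpace.toDual ℝ E).symm (LinearMap.toContinuousLinearMap ψ), fun x => ?_⟩
  rw [InnerProductSpace.toDual_symm_apply]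
  rfl

/-- If `0` is in the relative interior of the subdifferential, then strict complementarity at a
point for some subgradient implies strict complementarity for the zero subgradient. -/
theorem IsSDPRepresentation.exists_isStrictlyComplementary
    (hf : IsSDPRepresentation f A₀ 𝒜 c) {w : E × F} (hw : (A₀ + 𝒜 w).PosDef) {x₀ : E} {u₀ : F}
    (hx₀ : f x₀ = c u₀) {Z₁ : Matrix ι ι ℝ} (hZ₁ : IsStrictlyComplementary A₀ 𝒜 c x₀ u₀ Z₁)
    (h0 : (0 : E) ∈ intrinsicInterior ℝ (limitingSubdifferential f x₀)) :
    ∃ Z, IsStrictlyComplementary A₀ 𝒜 c x₀ u₀ Z ∧ ∀ x, (Z * 𝒜 (x, 0)).trace = 0 := by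
  obtain ⟨ζ, hζ⟩ := exists_inner_eq_trace_mul Z₁ 𝒜
  have hlt : f x₀ < ⊤ := hx₀ ▸ EReal.coe_lt_top _
  have hmem : ζ ∈ limitingSubdifferential f x₀ := by
    refine mem_limitingSubdifferential_of_le (hf.ne_bot _) hlt fun z => ?_
    rw [hx₀, hζ]
    refine EReal.le_of_forall_lt_iff_le.mp fun τ hτ => ?_
    obtain ⟨u, hu, hcu⟩ := (hf.le_iff z τ).mp hτ.le
    have h1 := hZ₁.dual.trace_mul_nonneg hu
    rw [hZ₁.trace_mul_eq] at h1
    norm_cast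
    linarith
  obtain ⟨ε, hε, hεmem⟩ := exists_neg_smul_mem_of_zero_mem_intrinsicInterior h0 hmem
  -- Since `-(ε • ζ)` is a subgradient at `x₀`, the point `(x₀, u₀)` minimizes this tilted objective
  -- over the feasible set.
  let ℓ : E × F →ₗ[ℝ] ℝ := c ∘ₗ LinearMap.snd ℝ E F +
    ε • ((innerSL ℝ ζ).toLinearMap ∘ₗ LinearMap.fst ℝ E F)
  have hℓ : ∀ x u, ℓ (x, u) = c u + ε * inner ℝ ζ x := fun _ _ => rfl
  obtain ⟨Z₂, hZ₂, hZ₂0, hZ₂ℓ⟩ := exists_dual_of_slater hf.isHermitian_const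
    hf.isHermitian_map ℓ hw hZ₁.primal (by
      rintro ⟨x, u⟩ hxu
      have h1 := le_sub_inner_of_mem_limitingSubdifferential hf.isConvexFun hf.ne_bot hεmem
        ((hf.le_iff x (c u)).mpr ⟨u, hxu, le_rfl⟩)
      rw [hx₀, EReal.coe_le_coe_iff, inner_neg_left, real_inner_smul_left, inner_sub_right] at h1
      rw [hℓ, hℓ]
      linarith)
  have hε1 : 0 < 1 + ε := by linarith
  have hcoef : ((1 + ε)⁻¹ * ε) + (1 + ε)⁻¹ = 1 := by
    field_simp
    ring
  -- `Z₁` represents `ζ` and `Z₂` represents `-(ε • ζ)`; these weights sum to `1` and cancel the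
  -- two. Positive definiteness comes from `Z₁`, whose weight is positive.
  refine ⟨((1 + ε)⁻¹ * ε) • Z₁ + (1 + ε)⁻¹ • Z₂, ⟨hZ₁.primal,
    (hZ₁.dual.smul (by positivity)).add (hZ₂.smul (by positivity)), ?_, ?_, fun u => ?_⟩,
    fun x => ?_⟩
  · rw [Matrix.add_mul, Matrix.smul_mul, Matrix.smul_mul, hZ₁.mul_eq_zero, hZ₂0]
    simp
  · have h1 : ((1 + ε)⁻¹ * ε) • Z₁ + (1 + ε)⁻¹ • Z₂ + (A₀ + 𝒜 (x₀, u₀)) =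
        ((1 + ε)⁻¹ * ε) • (Z₁ + (A₀ + 𝒜 (x₀, u₀))) + (1 + ε)⁻¹ • (Z₂ + (A₀ + 𝒜 (x₀, u₀))) := by
      have : A₀ + 𝒜 (x₀, u₀) = ((1 + ε)⁻¹ * ε) • (A₀ + 𝒜 (x₀, u₀)) +
          (1 + ε)⁻¹ • (A₀ + 𝒜 (x₀, u₀)) := by rw [← add_smul, hcoef, one_smul]
      conv_lhs => rw [this]
      rw [smul_add _ Z₁, smul_add _ Z₂]
      abel
    rw [h1]
    exact (hZ₁.posDef.smul (by positivity)).add_posSemidef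
      ((hZ₂.add hZ₁.primal).smul (by positivity))
  · have h2 := hZ₂ℓ (0, u)
    rw [hℓ, inner_zero_right, mul_zero, add_zero] at h2
    rw [Matrix.add_mul, Matrix.smul_mul, Matrix.smul_mul, Matrix.trace_add, Matrix.trace_smul,
      Matrix.trace_smul, hZ₁.trace_mul, h2, ← add_smul, hcoef, one_smul]
  · have h2 := hZ₂ℓ (x, 0)
    rw [hℓ, map_zero, zero_add, hζ] at h2
    rw [Matrix.add_mul, Matrix.smul_mul, Matrix.smul_mul, Matrix.trace_add, Matrix.trace_smul,
      Matrix.trace_smul, h2, smul_eq_mul, smul_eq_mul]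
    ring

variable [FiniteDimensional ℝ F]

attribute [local instance] Matrix.frobeniusNormedAddCommGroup Matrix.frobeniusNormedSpace

/-- Under strict complementarity, `f` grows quadratically away from its set of minimizers. -/
theorem IsSDPRepresentation.exists_quadratic_growth
    (hf : IsSDPRepresentation f A₀ 𝒜 c) {x₀ : E} {u₀ : F} {Z : Matrix ι ι ℝ}
    (hZ : IsStrictlyComplementary A₀ 𝒜 c x₀ u₀ Z) (hZ0 : ∀ x, (Z * 𝒜 (x, 0)).trace = 0) {B : ℝ}
    (hB : ∀ x u, ‖x - x₀‖ ≤ 1 → c u ≤ c u₀ + 1 → (A₀ + 𝒜 (x, u)).PosSemidef →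
      (A₀ + 𝒜 (x, u)).trace ≤ B) :
    ∃ C : ℝ, 0 < C ∧ ∃ δ : ℝ, 0 < δ ∧ ∀ x, ‖x - x₀‖ < δ → ∀ s : ℝ, 0 ≤ s → s < δ →
      f x ≤ ((c u₀ + s : ℝ) : EReal) → ∃ x', f x' ≤ c u₀ ∧ ‖x - x'‖ ≤ C * √s := by
  let T : E × F →ₗ[ℝ] Matrix ι ι ℝ := LinearMap.mulLeft ℝ Z ∘ₗ 𝒜
  have hT : ∀ y, T y = Z * 𝒜 y := fun _ => rfl
  obtain ⟨C₁, hC₁, h1⟩ := T.exists_mem_ker_norm_sub_le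
  -- Only `x` is known to be near `x₀`; `u` may be far from `u₀`. This bound replaces a kernel
  -- element by one with the same `E`-component whose norm is controlled by that component.
  obtain ⟨C₂, hC₂, h2⟩ :=
    (LinearMap.fst ℝ E F ∘ₗ (LinearMap.ker T).subtype).exists_mem_ker_norm_sub_le
  have hopen := Matrix.isOpen_setOf_forall_dotProduct_mulVec_pos (ι := ι)
  have hcont : Continuous fun y : E × F => Z + (A₀ + 𝒜 (x₀, u₀)) + 𝒜 y :=
    continuous_const.add (LinearMap.continuous_of_finiteDimensional 𝒜)
  have hnhds : ∀ᶠ y in 𝓝 (0 : E × F), ∀ x, x ≠ 0 →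
      0 < x ⬝ᵥ ((Z + (A₀ + 𝒜 (x₀, u₀)) + 𝒜 y) *ᵥ x) := by
    refine hcont.continuousAt (hopen.mem_nhds ?_)
    change ∀ x, x ≠ 0 → _
    rw [map_zero, add_zero]
    exact (Matrix.posDef_real_iff.mp hZ.posDef).2
  obtain ⟨η, hη, hball⟩ := Metric.eventually_nhds_iff.mp hnhds
  set D : ℝ := √(Z.trace * |B|) with hD
  have hD0 : 0 ≤ D := Real.sqrt_nonneg _
  set C : ℝ := C₁ * D + 1 with hC
  have hCpos : 0 < C := by positivity
  set κ : ℝ := η / (2 * C₂) with hκ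
  have hκpos : 0 < κ := by positivity
  -- The bound `1` is for `hB`, `κ` controls `‖x - x₀‖`, and `(κ / C) ^ 2` gives `C * √s < κ`; with
  -- `κ = η / (2 * C₂)` these yield `‖k‖ < η`.
  refine ⟨C, hCpos, min (min 1 κ) ((κ / C) ^ 2), by positivity, fun x hx s hs hsδ hfx => ?_⟩
  obtain ⟨u, hu, hcu⟩ := (hf.le_iff x _).mp hfx
  have hδ1 : min (min 1 κ) ((κ / C) ^ 2) ≤ 1 := (min_le_left _ _).trans (min_le_left _ _)
  have hδ2 : min (min 1 κ) ((κ / C) ^ 2) ≤ κ := (min_le_left _ _).trans (min_le_right _ _)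
  have hδ3 : min (min 1 κ) ((κ / C) ^ 2) ≤ (κ / C) ^ 2 := min_le_right _ _
  have hM := hB x u (by linarith) (by linarith) hu
  have htr : (Z * (A₀ + 𝒜 (x, u))).trace ≤ s := by
    rw [hZ.trace_mul_eq, hZ0]
    linarith
  have hTy : T (x - x₀, u - u₀) = Z * (A₀ + 𝒜 (x, u)) := by
    have : A₀ + 𝒜 (x, u) = (A₀ + 𝒜 (x₀, u₀)) + 𝒜 (x - x₀, u - u₀) := by
      rw [add_assoc, ← map_add]
      simp
    rw [this, Matrix.mul_add, hZ.mul_eq_zero, zero_add, hT]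
  have hnorm : ‖T (x - x₀, u - u₀)‖ ≤ D * √s := by
    rw [hTy, hD, ← Real.sqrt_mul (mul_nonneg hZ.dual.trace_nonneg (abs_nonneg _))]
    refine Real.le_sqrt_of_sq_le ((hZ.dual.norm_mul_sq_le hu).trans ?_)
    have e1 := hZ.dual.trace_nonneg
    have e2 := hu.trace_nonneg
    have e3 := hZ.dual.trace_mul_nonneg hu
    have e4 := hM.trans (le_abs_self B)
    gcongr
  obtain ⟨v, hv, hvn⟩ := h1 (x - x₀, u - u₀)
  have hker : (x - x₀, u - u₀) - v ∈ LinearMap.ker T := by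
    rw [LinearMap.mem_ker, map_sub, hv, sub_self]
  obtain ⟨⟨k, hk⟩, hk1, hkn⟩ := h2 ⟨_, hker⟩
  simp only [LinearMap.coe_comp, Function.comp_apply, Submodule.subtype_apply,
    LinearMap.fst_apply, Prod.fst_sub] at hk1 hkn
  have hv1 : ‖v.1‖ ≤ C * √s := by
    refine (norm_fst_le v).trans (hvn.trans ?_)
    have : C₁ * ‖T (x - x₀, u - u₀)‖ ≤ C₁ * (D * √s) := by gcongr
    rw [hC]
    nlinarith [Real.sqrt_nonneg s]
  have hsC : C * √s < κ := by
    have : √s < κ / C := by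
      rw [Real.sqrt_lt' (by positivity)]
      linarith
    rwa [lt_div_iff₀' hCpos] at this
  have hksmall : ‖k‖ < η := by
    have e1 : ‖x - x₀ - v.1‖ < κ + κ := by
      refine (norm_sub_le _ _).trans_lt ?_
      linarith
    calc ‖k‖ ≤ C₂ * ‖x - x₀ - v.1‖ := hkn
      _ < C₂ * (κ + κ) := by gcongr
      _ = η := by rw [hκ]; field_simp; ring
  have hkZ : Z * 𝒜 k = 0 := hk
  refine ⟨x₀ + k.1, ?_, ?_⟩
  · refine (hf.le_iff _ _).mpr ⟨u₀ + k.2, ?_, ?_⟩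
    · have e : A₀ + 𝒜 (x₀ + k.1, u₀ + k.2) = A₀ + 𝒜 (x₀, u₀) + 𝒜 k := by
        rw [add_assoc, ← map_add]
        rfl
      have hh : (A₀ + 𝒜 (x₀, u₀) + 𝒜 k).IsHermitian :=
        hZ.primal.isHermitian.add (hf.isHermitian_map k)
      rw [e]
      -- Feasibility of the shifted point comes from the linear equation `Z * 𝒜 k = 0` and the
      -- smallness of `k`.
      refine Matrix.posSemidef_of_mul_eq_zero hZ.dual.isHermitian hh ?_ ?_
      · rw [Matrix.mul_add, hZ.mul_eq_zero, hkZ, add_zero]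
      · refine Matrix.posDef_real_iff.mpr ⟨hZ.dual.isHermitian.add hh, ?_⟩
        rw [← add_assoc]
        exact hball (by simpa using hksmall)
    · have e : 𝒜 k = 𝒜 (k.1, 0) + 𝒜 (0, k.2) := by
        rw [← map_add]
        simp
      have := congrArg Matrix.trace hkZ
      rw [e, Matrix.mul_add, Matrix.trace_add, hZ0, hZ.trace_mul, Matrix.trace_zero,
        zero_add] at this
      rw [map_add, this, add_zero]
  · have : x - (x₀ + k.1) = v.1 := by rw [hk1]; abel
    rw [this]
    exact hv1

end SDP

/-! ### From quadratic growth to the Kurdyka-Łojasiewicz property -/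

theorem isDesingularizing_mul_rpow {c δ α : ℝ} (hc : 0 < c) (hα0 : 0 < α) (hα1 : α ≤ 1) :
    IsDesingularizing (δ : EReal) (fun s => c * s ^ α) where
  continuousOn :=
    (continuous_const.mul (Real.continuous_rpow_const hα0.le)).continuousOn
  concaveOn := by
    have h := ((Real.concaveOn_rpow hα0.le hα1).smul hc.le)
    have hset : {s : ℝ | 0 ≤ s ∧ (s : EReal) < δ} = Set.Ico 0 δ := by
      ext s
      simp
    rw [hset]
    exact h.subset Set.Ico_subset_Ici_self (convex_Ico 0 δ)
  nonneg := fun s hs _ => by positivity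
  map_zero := by simp [hα0.ne']
  contDiffOn := fun s hs =>
    (contDiffAt_const.mul (Real.contDiffAt_rpow_const_of_ne hs.1.ne')).contDiffWithinAt
  deriv_pos := fun s hs _ => by
    rw [deriv_const_mul _ (Real.differentiableAt_rpow_const_of_ne α hs.ne'),
      Real.deriv_rpow_const]
    positivity

/-- For a subgradient `ζ` at `x`, the gap satisfies `s ≤ ⟪ζ, x - x'⟫ ≤ ‖ζ‖ * C * √s`, so `‖ζ‖ ≥ √s /
C`. The factor `2 * C` makes the derivative of the desingularizing function exactly `C / √s`. -/
theorem hasKLExponent_half_of_quadratic_growth {E : Type*} [NormedAddCommGroup E]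
    [InnerProductSpace ℝ E] {f : E → EReal} (hf : IsProperClosed f) (hconv : IsConvexFun f)
    {x₀ : E} {v : ℝ} (hv : f x₀ = v) (hdom : x₀ ∈ domSubdifferential f) {C δ : ℝ} (hC : 0 < C)
    (hδ : 0 < δ) (hgrowth : ∀ x, ‖x - x₀‖ < δ → ∀ s : ℝ, 0 ≤ s → s < δ →
      f x ≤ ((v + s : ℝ) : EReal) → ∃ x', f x' ≤ v ∧ ‖x - x'‖ ≤ C * √s) :
    HasKLExponent f x₀ (1 / 2) := by
  refine ⟨by norm_num, by norm_num, 2 * C, by positivity, hf, hdom, δ, by exact_mod_cast hδ,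
    isDesingularizing_mul_rpow (by positivity) (by norm_num) (by norm_num), Metric.ball x₀ δ,
    Metric.ball_mem_nhds _ hδ, fun x hx hlt hgt => ?_⟩
  rw [mem_ball_iff_norm] at hx
  rw [hv] at hlt hgt ⊢
  obtain ⟨b, hb⟩ : ∃ b : ℝ, f x = b :=
    ⟨_, (EReal.coe_toReal (ne_top_of_lt hgt) (hf.1.1 x)).symm⟩
  rw [hb] at hlt hgt
  norm_cast at hlt hgt
  set s := b - v with hs
  have hs0 : 0 < s := by linarith
  have hss : 0 < √s := Real.sqrt_pos.mpr hs0
  obtain ⟨x', hx', hxx'⟩ := hgrowth x hx s hs0.le (by linarith) (by rw [hb, hs]; simp)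
  have hval : (f x - (v : EReal)).toReal = s := by
    rw [hb, ← EReal.coe_sub, EReal.toReal_coe]
  have hderiv : deriv (fun s : ℝ => 2 * C * s ^ (1 - 1 / 2 : ℝ)) s = C / √s := by
    rw [deriv_const_mul _ (Real.differentiableAt_rpow_const_of_ne _ hs0.ne'),
      Real.deriv_rpow_const, show (1 - 1 / 2 - 1 : ℝ) = -(1 / 2) by norm_num,
      Real.rpow_neg hs0.le, ← Real.sqrt_eq_rpow]
    field_simp
    norm_num
  have hdist : ENNReal.ofReal (√s / C) ≤ Metric.infEDist 0 (limitingSubdifferential f x) := by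
    refine Metric.le_infEDist.mpr fun ζ hζ => ?_
    rw [edist_dist, dist_zero_left]
    refine ENNReal.ofReal_le_ofReal ?_
    have h1 := le_sub_inner_of_mem_limitingSubdifferential hconv hf.1.1 hζ hx'
    rw [hb, EReal.coe_le_coe_iff] at h1
    have h2 : -inner ℝ ζ (x' - x) ≤ ‖ζ‖ * ‖x - x'‖ := by
      rw [← inner_neg_right, neg_sub]
      exact real_inner_le_norm _ _
    have h3 : √s * √s ≤ C * ‖ζ‖ * √s := by
      rw [Real.mul_self_sqrt hs0.le]
      calc s ≤ ‖ζ‖ * ‖x - x'‖ := by linarith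
        _ ≤ ‖ζ‖ * (C * √s) := by gcongr
        _ = C * ‖ζ‖ * √s := by ring
    rw [div_le_iff₀' hC]
    exact le_of_mul_le_mul_right h3 hss
  rw [hval, hderiv]
  calc (1 : ENNReal) = ENNReal.ofReal (C / √s) * ENNReal.ofReal (√s / C) := by
        rw [← ENNReal.ofReal_mul (by positivity), div_mul_div_cancel₀ hss.ne', div_self hC.ne',
          ENNReal.ofReal_one]
    _ ≤ _ := by gcongr

/-! ### The nuclear norm as the value of a semidefinite program -/

namespace Matrix

variable {μ ν : Type*} [Fintype μ] [Fintype ν]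

/-- A square root of `Xᵀ * X`, together with its pseudoinverse. -/
structure IsAbsWithPinv (X : Matrix μ ν ℝ) (S R : Matrix ν ν ℝ) : Prop where
  posSemidef : S.PosSemidef
  isHermitian : R.IsHermitian
  comm : S * R = R * S
  mul_self : S * S = Xᴴ * X
  mul_mul_left : S * R * S = S
  mul_mul_right : R * S * R = R

theorem dotProduct_fromBlocks_mulVec (A : Matrix μ μ ℝ) (B : Matrix μ ν ℝ) (C : Matrix ν μ ℝ)
    (D : Matrix ν ν ℝ) (x : μ ⊕ ν → ℝ) :
    x ⬝ᵥ (fromBlocks A B C D *ᵥ x) =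
      (x ∘ Sum.inl) ⬝ᵥ (A *ᵥ (x ∘ Sum.inl) + B *ᵥ (x ∘ Sum.inr)) +
      (x ∘ Sum.inr) ⬝ᵥ (C *ᵥ (x ∘ Sum.inl) + D *ᵥ (x ∘ Sum.inr)) := by
  rw [fromBlocks_mulVec]
  simp [dotProduct, Fintype.sum_sum_type]

theorem conjTranspose_mulVec_dotProduct (A : Matrix μ ν ℝ) (x : μ → ℝ) (y : ν → ℝ) :
    (Aᴴ *ᵥ x) ⬝ᵥ y = x ⬝ᵥ (A *ᵥ y) := by
  rw [conjTranspose_eq_transpose_of_trivial, mulVec_transpose, dotProduct_mulVec]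

variable [DecidableEq μ] [DecidableEq ν]

/-- The optimality certificate for the semidefinite program whose value is the trace of the
absolute value of `X`. -/
theorem IsAbsWithPinv.exists_certificate {X : Matrix μ ν ℝ} {S R : Matrix ν ν ℝ}
    (h : IsAbsWithPinv X S R) :
    ∃ (P : Matrix μ μ ℝ) (ζ : Matrix μ ν ℝ), P.trace = S.trace ∧
      (fromBlocks P X Xᴴ S).PosSemidef ∧ (fromBlocks 1 (-ζ) (-ζᴴ) 1).PosSemidef ∧
      fromBlocks 1 (-ζ) (-ζᴴ) 1 * fromBlocks P X Xᴴ S = 0 ∧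
      (fromBlocks 1 (-ζ) (-ζᴴ) 1 + fromBlocks P X Xᴴ S).PosDef := by
  -- This is the partial isometry of the polar decomposition: `X = ζ * S`, and `ζᴴ * ζ = R * S` is
  -- the projection onto the range of `S`.
  set ζ := X * R with hζ
  have hRS : R * S * S = S := by rw [← h.comm, h.mul_mul_left]
  have hζζ : ζᴴ * ζ = R * S := by
    rw [hζ, conjTranspose_mul, h.isHermitian.eq, Matrix.mul_assoc, ← Matrix.mul_assoc Xᴴ,
      ← h.mul_self, ← Matrix.mul_assoc, ← Matrix.mul_assoc, hRS, h.comm]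
  have hX : X = ζ * S := by
    rw [← sub_eq_zero, ← conjTranspose_mul_self_eq_zero]
    have e1 : (R * S)ᴴ = R * S := by
      rw [conjTranspose_mul, h.isHermitian.eq, h.posSemidef.isHermitian.eq, h.comm]
    have e2 : X - ζ * S = X * (1 - R * S) := by
      rw [hζ, Matrix.mul_sub, Matrix.mul_one, Matrix.mul_assoc]
    rw [e2, conjTranspose_mul, conjTranspose_sub, e1, conjTranspose_one, Matrix.mul_assoc,
      ← Matrix.mul_assoc Xᴴ, ← h.mul_self, ← Matrix.mul_assoc, ← Matrix.mul_assoc,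
      Matrix.sub_mul, hRS, Matrix.one_mul, sub_self, Matrix.zero_mul, Matrix.zero_mul]
  have hXt : Xᴴ = S * ζᴴ := by
    conv_lhs => rw [hX, conjTranspose_mul, h.posSemidef.isHermitian.eq]
  have hζX : ζᴴ * X = S := by
    conv_lhs => rw [hX, ← Matrix.mul_assoc, hζζ, hRS]
  have hSh := h.posSemidef.isHermitian
  have hP : (fromBlocks (X * ζᴴ) X Xᴴ S).IsHermitian ∧ ∀ x : μ ⊕ ν → ℝ,
      x ⬝ᵥ (fromBlocks (X * ζᴴ) X Xᴴ S *ᵥ x) =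
        (ζᴴ *ᵥ (x ∘ Sum.inl) + x ∘ Sum.inr) ⬝ᵥ
          (S *ᵥ (ζᴴ *ᵥ (x ∘ Sum.inl) + x ∘ Sum.inr)) := by
    refine ⟨IsHermitian.fromBlocks ?_ rfl hSh, fun x => ?_⟩
    · rw [IsHermitian, conjTranspose_mul, conjTranspose_conjTranspose, hXt, ← Matrix.mul_assoc,
        ← hX]
    · rw [dotProduct_fromBlocks_mulVec, mulVec_add, add_dotProduct,
        conjTranspose_mulVec_dotProduct, mulVec_add, mulVec_mulVec, mulVec_mulVec, mulVec_mulVec,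
        ← hX, hXt, mulVec_mulVec]
  have hZ : (fromBlocks 1 (-ζ) (-ζᴴ) 1).IsHermitian ∧ ∀ x : μ ⊕ ν → ℝ,
      x ⬝ᵥ (fromBlocks 1 (-ζ) (-ζᴴ) 1 *ᵥ x) =
        (x ∘ Sum.inl - ζ *ᵥ (x ∘ Sum.inr)) ⬝ᵥ (x ∘ Sum.inl - ζ *ᵥ (x ∘ Sum.inr)) +
          (x ∘ Sum.inr - (R * S) *ᵥ (x ∘ Sum.inr)) ⬝ᵥ
            (x ∘ Sum.inr - (R * S) *ᵥ (x ∘ Sum.inr)) := by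
    refine ⟨IsHermitian.fromBlocks isHermitian_one (conjTranspose_neg ζ) isHermitian_one,
      fun x => ?_⟩
    rw [dotProduct_fromBlocks_mulVec, one_mulVec, one_mulVec, neg_mulVec, neg_mulVec]
    set a := x ∘ Sum.inl
    set b := x ∘ Sum.inr
    have e1 : b ⬝ᵥ (ζᴴ *ᵥ a) = a ⬝ᵥ (ζ *ᵥ b) := by
      rw [dotProduct_comm, conjTranspose_mulVec_dotProduct]
    have e2 : (ζ *ᵥ b) ⬝ᵥ (ζ *ᵥ b) = b ⬝ᵥ ((R * S) *ᵥ b) := by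
      rw [← conjTranspose_mulVec_dotProduct, mulVec_mulVec, hζζ, dotProduct_comm]
    have e3 : ((R * S) *ᵥ b) ⬝ᵥ ((R * S) *ᵥ b) = b ⬝ᵥ ((R * S) *ᵥ b) := by
      have e4 : (R * S)ᴴ = R * S := by rw [← hζζ, conjTranspose_mul, conjTranspose_conjTranspose]
      conv_lhs => rw [← e4]
      rw [conjTranspose_mulVec_dotProduct, mulVec_mulVec, e4, ← Matrix.mul_assoc,
        h.mul_mul_right]
    simp only [dotProduct_add, dotProduct_neg, dotProduct_sub, sub_dotProduct, e1, e2, e3,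
      dotProduct_comm (ζ *ᵥ b) a, dotProduct_comm ((R * S) *ᵥ b) b]
    ring
  have hmul : fromBlocks 1 (-ζ) (-ζᴴ) 1 * fromBlocks (X * ζᴴ) X Xᴴ S = 0 := by
    rw [fromBlocks_multiply, ← fromBlocks_zero]
    congr 1
    · rw [hXt, Matrix.one_mul, Matrix.neg_mul, ← Matrix.mul_assoc, ← hX, add_neg_cancel]
    · rw [Matrix.neg_mul, ← hX, Matrix.one_mul, add_neg_cancel]
    · rw [Matrix.neg_mul, ← Matrix.mul_assoc, hζX, Matrix.one_mul, hXt, neg_add_cancel]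
    · rw [Matrix.neg_mul, hζX, Matrix.one_mul, neg_add_cancel]
  have hPpsd : (fromBlocks (X * ζᴴ) X Xᴴ S).PosSemidef :=
    posSemidef_real_iff.mpr ⟨hP.1, fun x => by
      rw [hP.2]
      exact (posSemidef_real_iff.mp h.posSemidef).2 _⟩
  have hZpsd : (fromBlocks 1 (-ζ) (-ζᴴ) 1).PosSemidef :=
    posSemidef_real_iff.mpr ⟨hZ.1, fun x => by
      rw [hZ.2]
      exact add_nonneg (dotProduct_self_star_nonneg _) (dotProduct_self_star_nonneg _)⟩
  refine ⟨X * ζᴴ, ζ, ?_, hPpsd, hZpsd, hmul, posDef_real_iff.mpr ⟨hZ.1.add hP.1, fun x hx => ?_⟩⟩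
  · rw [trace_mul_comm, hζX]
  · rw [add_mulVec, dotProduct_add]
    have h1 := (posSemidef_real_iff.mp hPpsd).2 x
    have h2 := (posSemidef_real_iff.mp hZpsd).2 x
    refine lt_of_le_of_ne (add_nonneg h2 h1) fun h0 => hx ?_
    have h3 : x ⬝ᵥ (fromBlocks 1 (-ζ) (-ζᴴ) 1 *ᵥ x) = 0 := by linarith
    have h4 : x ⬝ᵥ (fromBlocks (X * ζᴴ) X Xᴴ S *ᵥ x) = 0 := by linarith
    rw [hZ.2] at h3
    rw [hP.2] at h4
    set a := x ∘ Sum.inl with ha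
    set b := x ∘ Sum.inr with hb
    have h5 : 0 ≤ (a - ζ *ᵥ b) ⬝ᵥ (a - ζ *ᵥ b) := dotProduct_self_star_nonneg _
    have h6 : 0 ≤ (b - (R * S) *ᵥ b) ⬝ᵥ (b - (R * S) *ᵥ b) := dotProduct_self_star_nonneg _
    have h7 : a = ζ *ᵥ b := sub_eq_zero.mp (dotProduct_self_eq_zero.mp (by linarith))
    have h8 : b = (R * S) *ᵥ b := sub_eq_zero.mp (dotProduct_self_eq_zero.mp (by linarith))
    -- The vanishing of the other form then puts `2b` in the kernel of `S`, while `b = R S b`; hence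
    -- `b = 0` and `a = ζ b = 0`.
    have h9 : ζᴴ *ᵥ a = b := by rw [h7, mulVec_mulVec, hζζ, ← h8]
    have h10 := (h.posSemidef.dotProduct_mulVec_zero_iff _).mp (by rw [star_trivial]; exact h4)
    have h11 : S *ᵥ b = 0 := by
      rw [h9, ← two_smul ℝ b, mulVec_smul] at h10
      simpa using h10
    have h12 : b = 0 := by rw [h8, ← mulVec_mulVec, h11, mulVec_zero]
    have h13 : a = 0 := by rw [h7, h12, mulVec_zero]
    rw [← Sum.elim_comp_inl_inr x, ← ha, ← hb, h12, h13]
    exact Sum.elim_zero_zero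

end Matrix

theorem Matrix.exists_isAbsWithPinv {μ ν : Type*} [Fintype μ] [Fintype ν] [DecidableEq ν]
    (X : Matrix μ ν ℝ) : ∃ S R, IsAbsWithPinv X S R ∧
      S.trace = ∑ i, √((isHermitian_conjTranspose_mul_self X).eigenvalues i) := by
  set H := isHermitian_conjTranspose_mul_self X
  set U : Matrix ν ν ℝ := H.eigenvectorUnitary.1
  set σ : ν → ℝ := fun i => √(H.eigenvalues i) with hσ
  have hUU : Uᴴ * U = 1 := Unitary.coe_star_mul_self H.eigenvectorUnitary
  have hmul : ∀ d e : ν → ℝ, U * diagonal d * Uᴴ * (U * diagonal e * Uᴴ) =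
      U * diagonal (fun i => d i * e i) * Uᴴ := by
    intro d e
    calc _ = U * (diagonal d * (Uᴴ * U) * diagonal e) * Uᴴ := by simp only [Matrix.mul_assoc]
      _ = _ := by rw [hUU, Matrix.mul_one, diagonal_mul_diagonal]
  have hspec : Xᴴ * X = U * diagonal H.eigenvalues * Uᴴ := by
    have := H.spectral_theorem
    rw [Unitary.conjStarAlgAut_apply] at this
    exact this
  have hherm : ∀ d : ν → ℝ, (U * diagonal d * Uᴴ).IsHermitian := fun d =>
    isHermitian_mul_mul_conjTranspose _ (isHermitian_diagonal d)
  -- The convention `0⁻¹ = 0` makes the second matrix the pseudoinverse.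
  refine ⟨U * diagonal σ * Uᴴ, U * diagonal (fun i => (σ i)⁻¹) * Uᴴ,
    ⟨?_, hherm _, ?_, ?_, ?_, ?_⟩, ?_⟩
  · exact (PosSemidef.diagonal fun i => Real.sqrt_nonneg _).mul_mul_conjTranspose_same U
  · rw [hmul, hmul]
    simp only [mul_comm]
  · rw [hmul, hspec]
    have := fun i => Real.mul_self_sqrt ((posSemidef_conjTranspose_mul_self X).eigenvalues_nonneg i)
    simp only [hσ]
    congr 3
    funext i
    exact this i
  · rw [hmul, hmul]
    simp only [mul_inv_mul_cancel]
  · rw [hmul, hmul]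
    have := fun i => mul_inv_mul_cancel (σ i)⁻¹
    simp only [inv_inv] at this
    simp only [this]
  · rw [trace_mul_comm, ← Matrix.mul_assoc, hUU, Matrix.one_mul, trace_diagonal]

/-- The nuclear norm is the trace of the absolute value. -/
theorem nuclearNorm_eq_sum_sqrt_eigenvalues {m n : ℕ} (X : MatSpace m n) : nuclearNorm X =
    ∑ i, √((Matrix.isHermitian_conjTranspose_mul_self X.toMatrix).eigenvalues i) := by
  set H := Matrix.isHermitian_conjTranspose_mul_self X.toMatrix
  set T := Matrix.toEuclideanLin X.toMatrix with hT
  have hop : Matrix.toEuclideanLin (X.toMatrixᴴ * X.toMatrix) = LinearMap.adjoint T ∘ₗ T := by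
    rw [hT, ← Matrix.toEuclideanLin_conjTranspose_eq_adjoint, ← Matrix.toLpLin_mul]
  have heig : ∀ {G₁ G₂ : EuclideanSpace ℝ (Fin n) →ₗ[ℝ] EuclideanSpace ℝ (Fin n)}
      (h₁ : G₁.IsSymmetric) (h₂ : G₂.IsSymmetric) {N : ℕ}
      (hN : Module.finrank ℝ (EuclideanSpace ℝ (Fin n)) = N) (i : Fin N), G₁ = G₂ →
      h₁.eigenvalues hN i = h₂.eigenvalues hN i := by
    rintro G₁ _ h₁ h₂ N hN i rfl
    rfl
  have hsv : ∀ i, √(H.eigenvalues₀ i) = T.singularValues i := by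
    intro i
    rw [T.singularValues_fin finrank_euclideanSpace, Matrix.IsHermitian.eigenvalues₀]
    congr 1
    exact heig _ _ _ _ hop
  have hsum : ∑ i, √(H.eigenvalues i) = ∑ k ∈ Finset.range n, T.singularValues k := by
    have : ∑ i, √(H.eigenvalues i) = ∑ i, √(H.eigenvalues₀ i) :=
      Equiv.sum_comp (Fintype.equivOfCardEq (Fintype.card_fin _)).symm
        fun i => √(H.eigenvalues₀ i)
    rw [this]
    simp only [hsv]
    rw [Fin.sum_univ_eq_sum_range (fun k => T.singularValues k), Fintype.card_fin]
  rw [hsum, nuclearNorm]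
  -- The eigenvalue sum has `n` terms; those of index at least `m` vanish because the rank is at
  -- most `m`.
  refine Finset.sum_subset (Finset.range_mono (min_le_right _ _)) fun k hk hk' => ?_
  rw [LinearMap.singularValues_eq_zero_iff_le_finrank_range]
  have h1 : Module.finrank ℝ (LinearMap.range T) ≤ m :=
    (Submodule.finrank_le _).trans_eq finrank_euclideanSpace_fin
  simp only [Finset.mem_range, lt_min_iff, not_and_or, not_lt] at hk hk'
  exact h1.trans (by omega)

namespace Matrix

variable {μ ν : Type*}

/-- The sum dominates `min α 1 • (Q + P)`. Thus multipliers can be rescaled without losing strict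
complementarity. -/
theorem PosDef.smul_add {Q P : Matrix μ μ ℝ} (hQ : Q.PosSemidef) (hP : P.PosSemidef)
    (h : (Q + P).PosDef) {α : ℝ} (hα : 0 < α) : (α • Q + P).PosDef := by
  have e : α • Q + P = min α 1 • (Q + P) + ((α - min α 1) • Q + (1 - min α 1) • P) := by
    module
  rw [e]
  have h1 : 0 ≤ α - min α 1 := sub_nonneg.mpr (min_le_left _ _)
  have h2 : 0 ≤ 1 - min α 1 := sub_nonneg.mpr (min_le_right _ _)
  exact (h.smul (lt_min hα one_pos)).add_posSemidef ((hQ.smul h1).add (hP.smul h2))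

variable [Fintype μ] [Fintype ν]

theorem trace_fromBlocks (A : Matrix μ μ ℝ) (B : Matrix μ ν ℝ) (C : Matrix ν μ ℝ)
    (D : Matrix ν ν ℝ) : (fromBlocks A B C D).trace = A.trace + D.trace := by
  simp [trace, Fintype.sum_sum_type]

theorem posSemidef_fromBlocks_zero_iff {A : Matrix μ μ ℝ} {D : Matrix ν ν ℝ} :
    (fromBlocks A 0 0 D).PosSemidef ↔ A.PosSemidef ∧ D.PosSemidef := by
  refine ⟨fun h => ⟨h.submatrix Sum.inl, h.submatrix Sum.inr⟩, fun h =>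
    posSemidef_real_iff.mpr ⟨IsHermitian.fromBlocks h.1.isHermitian conjTranspose_zero
      h.2.isHermitian, fun x => ?_⟩⟩
  rw [dotProduct_fromBlocks_mulVec, zero_mulVec, zero_mulVec, add_zero, zero_add]
  exact add_nonneg ((posSemidef_real_iff.mp h.1).2 _) ((posSemidef_real_iff.mp h.2).2 _)

theorem PosDef.fromBlocks_zero {A : Matrix μ μ ℝ} {D : Matrix ν ν ℝ} (hA : A.PosDef)
    (hD : D.PosDef) : (fromBlocks A 0 0 D).PosDef := by
  refine posDef_real_iff.mpr ⟨IsHermitian.fromBlocks hA.isHermitian conjTranspose_zero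
      hD.isHermitian, fun x hx => ?_⟩
  rw [dotProduct_fromBlocks_mulVec, zero_mulVec, zero_mulVec, add_zero, zero_add]
  have h1 := (posSemidef_real_iff.mp hA.posSemidef).2 (x ∘ Sum.inl)
  have h2 := (posSemidef_real_iff.mp hD.posSemidef).2 (x ∘ Sum.inr)
  by_cases h : x ∘ Sum.inl = 0
  · refine add_pos_of_nonneg_of_pos h1 ((posDef_real_iff.mp hD).2 _ fun h' => hx ?_)
    rw [← Sum.elim_comp_inl_inr x, h, h']
    exact Sum.elim_zero_zero
  · exact add_pos_of_pos_of_nonneg ((posDef_real_iff.mp hA).2 _ h) h2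

/-- The orthogonal projection onto the kernel of a positive semidefinite matrix. -/
theorem PosSemidef.exists_complementary [DecidableEq μ] {P : Matrix μ μ ℝ} (hP : P.PosSemidef) :
    ∃ Q : Matrix μ μ ℝ, Q.PosSemidef ∧ Q * P = 0 ∧ (Q + P).PosDef := by
  have H := hP.isHermitian
  set U : Matrix μ μ ℝ := H.eigenvectorUnitary.1
  have hUU : Uᴴ * U = 1 := Unitary.coe_star_mul_self H.eigenvectorUnitary
  have hUU' : U * Uᴴ = 1 := Unitary.coe_mul_star_self H.eigenvectorUnitary
  have hspec : P = U * diagonal H.eigenvalues * Uᴴ := by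
    have := H.spectral_theorem
    rw [Unitary.conjStarAlgAut_apply] at this
    exact this
  set q : μ → ℝ := fun i => if H.eigenvalues i = 0 then 1 else 0 with hq
  refine ⟨U * diagonal q * Uᴴ, ?_, ?_, ?_⟩
  · refine (PosSemidef.diagonal fun i => ?_).mul_mul_conjTranspose_same U
    simp only [hq, Pi.zero_apply]
    split_ifs <;> norm_num
  · conv_lhs => rw [hspec]
    calc _ = U * (diagonal q * (Uᴴ * U) * diagonal H.eigenvalues) * Uᴴ := by
          simp only [Matrix.mul_assoc]
      _ = 0 := by
          rw [hUU, Matrix.mul_one, diagonal_mul_diagonal]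
          have : (fun i => q i * H.eigenvalues i) = 0 := by
            funext i
            simp only [hq, Pi.zero_apply]
            split_ifs with h <;> simp [h]
          rw [this]
          simp
  · have e : U * diagonal q * Uᴴ + P = U * diagonal (fun i => q i + H.eigenvalues i) * Uᴴ := by
      conv_lhs => rw [hspec]
      rw [← Matrix.add_mul, ← Matrix.mul_add, diagonal_add]
    rw [e]
    refine PosDef.mul_mul_conjTranspose_same (PosDef.diagonal fun i => ?_) ?_
    · have h0 := hP.eigenvalues_nonneg i
      simp only [hq]
      split_ifs with h
      · simp [h]
      · rw [zero_add]
        exact lt_of_le_of_ne h0 (Ne.symm h)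
    · refine Function.HasLeftInverse.injective ⟨fun v => v ᵥ* Uᴴ, fun v => ?_⟩
      simp only [vecMul_vecMul]
      rw [hUU', vecMul_one]

end Matrix

/-! ### Functions whose epigraph is described by a linear matrix inequality -/

section Pencil

variable {m n d : ℕ} {B A₀ : Matrix (Fin d) (Fin d) ℝ}
  {A : Fin m → Fin n → Matrix (Fin d) (Fin d) ℝ}

theorem isHermitian_lmiPencil (hB : B.IsHermitian) (hA₀ : A₀.IsHermitian)
    (hA : ∀ i j, (A i j).IsHermitian) (X : MatSpace m n) (t : ℝ) :
    (lmiPencil B A₀ A X t).IsHermitian := by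
  have hs : ∀ (r : ℝ) {M : Matrix (Fin d) (Fin d) ℝ}, M.IsHermitian → (r • M).IsHermitian := by
    intro r M hM
    rw [Matrix.IsHermitian, Matrix.conjTranspose_smul, hM.eq, star_trivial]
  have hsum : (∑ i, ∑ j, X (i, j) • A i j).IsHermitian := by
    rw [Matrix.IsHermitian, Matrix.conjTranspose_sum]
    refine Finset.sum_congr rfl fun i _ => ?_
    rw [Matrix.conjTranspose_sum]
    exact Finset.sum_congr rfl fun j _ => hs _ (hA i j)
  exact (hB.add hsum).add (hs _ hA₀)

theorem lmiPencil_add_add (B' : Matrix (Fin d) (Fin d) ℝ) (X Y : MatSpace m n) (s t : ℝ) :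
    lmiPencil (B + B') A₀ A (X + Y) (s + t) = lmiPencil B A₀ A X s + lmiPencil B' A₀ A Y t := by
  simp only [lmiPencil, PiLp.add_apply, add_smul, Finset.sum_add_distrib]
  abel

theorem lmiPencil_smul (r : ℝ) (X : MatSpace m n) (t : ℝ) :
    lmiPencil 0 A₀ A (r • X) (r * t) = r • lmiPencil 0 A₀ A X t := by
  simp only [lmiPencil, PiLp.smul_apply, smul_eq_mul, mul_smul, smul_add, Finset.smul_sum,
    smul_zero]

theorem lmiPencil_add_snd (X : MatSpace m n) (s t : ℝ) :
    lmiPencil B A₀ A X (s + t) = lmiPencil B A₀ A X s + t • A₀ := by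
  simp only [lmiPencil, add_smul]
  abel

theorem continuous_lmiPencil (t : ℝ) : Continuous fun X => lmiPencil B A₀ A X t := by
  unfold lmiPencil
  fun_prop

variable {f : MatSpace m n → EReal}

/-- The epigraph is closed under increasing `t`, so a direction in which `A₀` is negative would
break the matrix inequality for large `t`. -/
theorem posSemidef_of_epi_eq (hepi : ∀ X t, f X ≤ ((t : ℝ) : EReal) ↔
      (lmiPencil B A₀ A X t).PosSemidef) (hA₀ : A₀.IsHermitian) {X : MatSpace m n} {r : ℝ}
    (hr : f X = r) : A₀.PosSemidef := by
  refine Matrix.posSemidef_real_iff.mpr ⟨hA₀, fun x => ?_⟩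
  by_contra! hneg
  set P := lmiPencil B A₀ A X r
  set s : ℝ := (|x ⬝ᵥ (P *ᵥ x)| + 1) / -(x ⬝ᵥ (A₀ *ᵥ x)) with hs
  have hs0 : 0 < s := div_pos (by positivity) (by linarith)
  have h1 : (P + s • A₀).PosSemidef := by
    rw [← lmiPencil_add_snd]
    refine (hepi _ _).mp ?_
    rw [hr]
    exact_mod_cast (by linarith : r ≤ r + s)
  have h2 := (Matrix.posSemidef_real_iff.mp h1).2 x
  rw [Matrix.add_mulVec, Matrix.smul_mulVec, dotProduct_add, dotProduct_smul, smul_eq_mul] at h2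
  have h3 : s * -(x ⬝ᵥ (A₀ *ᵥ x)) = |x ⬝ᵥ (P *ᵥ x)| + 1 :=
    div_mul_cancel₀ _ (by linarith)
  linarith [le_abs_self (x ⬝ᵥ (P *ᵥ x))]

/-- A strictly complementary multiplier which represents a subgradient. -/
theorem exists_multiplier (hepi : ∀ X t, f X ≤ ((t : ℝ) : EReal) ↔
      (lmiPencil B A₀ A X t).PosSemidef) (hA₀ : A₀.IsHermitian)
    {X : MatSpace m n} {r : ℝ} (hr : f X = r) :
    ∃ Z : Matrix (Fin d) (Fin d) ℝ, Z.PosSemidef ∧ Z * lmiPencil B A₀ A X r = 0 ∧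
      (Z + lmiPencil B A₀ A X r).PosDef ∧ (Z * A₀).trace = 1 := by
  have hP : (lmiPencil B A₀ A X r).PosSemidef := (hepi _ _).mp hr.le
  set P := lmiPencil B A₀ A X r with hPdef
  have hA₀psd := posSemidef_of_epi_eq hepi hA₀ hr
  obtain ⟨Q, hQ, hQP, hQPd⟩ := hP.exists_complementary
  -- Otherwise `Q * A₀ = 0`, and `P - ε • A₀` stays positive semidefinite for small `ε > 0`; this
  -- would give `f X ≤ r - ε`.
  have hne : (Q * A₀).trace ≠ 0 := by
    intro h0
    have hQA := hQ.mul_eq_zero_of_trace_mul_eq_zero hA₀psd h0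
    have hcont : Continuous fun ε : ℝ => Q + (P + (-ε) • A₀) := by fun_prop
    have hev : ∀ᶠ ε : ℝ in 𝓝 0, ∀ x, x ≠ 0 → 0 < x ⬝ᵥ ((Q + (P + (-ε) • A₀)) *ᵥ x) := by
      refine hcont.continuousAt
        (Matrix.isOpen_setOf_forall_dotProduct_mulVec_pos.mem_nhds ?_)
      rw [neg_zero, zero_smul, add_zero]
      exact (Matrix.posDef_real_iff.mp hQPd).2
    have hpos : ∀ᶠ ε : ℝ in 𝓝[>] 0, 0 < ε := self_mem_nhdsWithin
    obtain ⟨ε, hε, hε0⟩ := ((hev.filter_mono nhdsWithin_le_nhds).and hpos).exists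
    have hh : (P + (-ε) • A₀).IsHermitian := by
      refine hP.isHermitian.add ?_
      rw [Matrix.IsHermitian, Matrix.conjTranspose_smul, hA₀.eq, star_trivial]
    have h1 : (P + (-ε) • A₀).PosSemidef := by
      refine Matrix.posSemidef_of_mul_eq_zero hQ.isHermitian hh ?_
        (Matrix.posDef_real_iff.mpr ⟨hQ.isHermitian.add hh, hε⟩)
      rw [Matrix.mul_add, hQP, Matrix.mul_smul, hQA, smul_zero, add_zero]
    rw [hPdef, ← lmiPencil_add_snd] at h1
    have h2 := (hepi _ _).mpr h1
    rw [hr, EReal.coe_le_coe_iff] at h2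
    linarith
  have hpos : 0 < (Q * A₀).trace := lt_of_le_of_ne (hQ.trace_mul_nonneg hA₀psd) (Ne.symm hne)
  refine ⟨((Q * A₀).trace)⁻¹ • Q, hQ.smul (by positivity), ?_,
    Matrix.PosDef.smul_add hQ hP hQPd (by positivity), ?_⟩
  · rw [Matrix.smul_mul, hQP, smul_zero]
  · rw [Matrix.smul_mul, Matrix.trace_smul, smul_eq_mul, inv_mul_cancel₀ hne]

/-- Pairing the pencil with `Z` gives `0 ≤ tr (Z * lmiPencil B A₀ A X 0) + t`, and the first term is
bounded on the unit ball around `X₀`. -/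
theorem exists_bounds_of_posSemidef_lmiPencil {Z : Matrix (Fin d) (Fin d) ℝ}
    (hZ : Z.PosSemidef) (hZA : (Z * A₀).trace = 1) (X₀ : MatSpace m n) :
    ∃ a D : ℝ, ∀ X t, ‖X - X₀‖ ≤ 1 → (lmiPencil B A₀ A X t).PosSemidef →
      a ≤ t ∧ (lmiPencil B A₀ A X t).trace ≤ D + t * A₀.trace := by
  have hK := isCompact_closedBall X₀ 1
  have hc := continuous_lmiPencil (B := B) (A₀ := A₀) (A := A) 0
  obtain ⟨a, ha⟩ := hK.exists_bound_of_continuousOn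
    (f := fun X => (Z * lmiPencil B A₀ A X 0).trace)
    (Continuous.matrix_trace (by fun_prop)).continuousOn
  obtain ⟨D, hD⟩ := hK.exists_bound_of_continuousOn (f := fun X => (lmiPencil B A₀ A X 0).trace)
    (Continuous.matrix_trace hc).continuousOn
  refine ⟨-a, D, fun X t hX hpsd => ?_⟩
  have hmem : X ∈ Metric.closedBall X₀ 1 := mem_closedBall_iff_norm.mpr hX
  have e : lmiPencil B A₀ A X t = lmiPencil B A₀ A X 0 + t • A₀ := by
    rw [← lmiPencil_add_snd, zero_add]
  have h1 := hZ.trace_mul_nonneg hpsd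
  rw [e] at h1 ⊢
  rw [Matrix.mul_add, Matrix.trace_add, Matrix.mul_smul, Matrix.trace_smul, hZA] at h1
  rw [Matrix.trace_add, Matrix.trace_smul]
  have h2 := (le_abs_self _).trans (ha X hmem)
  have h3 := (le_abs_self _).trans (hD X hmem)
  simp only [smul_eq_mul] at h1 h2 h3 ⊢
  constructor <;> linarith

end Pencil

/-! ### Semidefinite certificates for the nuclear norm -/

section NuclearNorm

variable {m n : ℕ}

/-- `P` and `S` solve the primal program, `ζ` the dual one. Taking the trace of the zero product
gives `tr (ζᴴ X) = nuclearNorm X`. -/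
theorem exists_nuclearNorm_certificate (X : MatSpace m n) :
    ∃ (P : Matrix (Fin m) (Fin m) ℝ) (S : Matrix (Fin n) (Fin n) ℝ)
      (ζ : Matrix (Fin m) (Fin n) ℝ), P.trace = nuclearNorm X ∧ S.trace = nuclearNorm X ∧
      (Matrix.fromBlocks P X.toMatrix X.toMatrixᴴ S).PosSemidef ∧
      (Matrix.fromBlocks 1 (-ζ) (-ζᴴ) 1).PosSemidef ∧
      Matrix.fromBlocks 1 (-ζ) (-ζᴴ) 1 * Matrix.fromBlocks P X.toMatrix X.toMatrixᴴ S = 0 ∧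
      (Matrix.fromBlocks 1 (-ζ) (-ζᴴ) 1 +
        Matrix.fromBlocks P X.toMatrix X.toMatrixᴴ S).PosDef := by
  obtain ⟨S, R, h, hS⟩ := Matrix.exists_isAbsWithPinv X.toMatrix
  rw [← nuclearNorm_eq_sum_sqrt_eigenvalues] at hS
  obtain ⟨P, ζ, hP, h1⟩ := h.exists_certificate
  exact ⟨P, S, ζ, hP.trans hS, hS, h1⟩

theorem trace_fromBlocks_mul_fromBlocks (ζ X : Matrix (Fin m) (Fin n) ℝ)
    (P : Matrix (Fin m) (Fin m) ℝ) (S : Matrix (Fin n) (Fin n) ℝ) :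
    (Matrix.fromBlocks 1 (-ζ) (-ζᴴ) 1 * Matrix.fromBlocks P X Xᴴ S).trace =
      P.trace + S.trace - 2 * (ζᴴ * X).trace := by
  have : (ζ * Xᴴ).trace = (ζᴴ * X).trace := by
    conv_rhs => rw [← star_trivial (ζᴴ * X).trace, ← Matrix.trace_conjTranspose,
      Matrix.conjTranspose_mul, Matrix.conjTranspose_conjTranspose, Matrix.trace_mul_comm]
  rw [Matrix.fromBlocks_multiply, Matrix.trace_fromBlocks]
  simp only [Matrix.one_mul, Matrix.neg_mul, Matrix.trace_add, Matrix.trace_neg, this]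
  ring

/-- Weak duality: pair the block matrix with the dual certificate of `X`. -/
theorem two_mul_nuclearNorm_le {X : MatSpace m n} {P : Matrix (Fin m) (Fin m) ℝ}
    {S : Matrix (Fin n) (Fin n) ℝ}
    (h : (Matrix.fromBlocks P X.toMatrix X.toMatrixᴴ S).PosSemidef) :
    2 * nuclearNorm X ≤ P.trace + S.trace := by
  obtain ⟨P', S', ζ, hP', hS', -, hZ, h0, -⟩ := exists_nuclearNorm_certificate X
  have h1 := congrArg Matrix.trace h0
  have h2 := hZ.trace_mul_nonneg h
  rw [trace_fromBlocks_mul_fromBlocks] at h1 h2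
  rw [Matrix.trace_zero] at h1
  linarith

/-- The dual certificate at `X` supplies a continuous linear minorant `Y ↦ tr (ζᴴ Y)` that is exact
at `X`. -/
theorem lowerSemicontinuous_nuclearNorm :
    LowerSemicontinuous (nuclearNorm : MatSpace m n → ℝ) := by
  intro X c hc
  obtain ⟨P, S, ζ, hP, hS, -, hZ, h0, -⟩ := exists_nuclearNorm_certificate X
  have h1 := congrArg Matrix.trace h0
  rw [trace_fromBlocks_mul_fromBlocks, Matrix.trace_zero] at h1
  have hcont : Continuous fun Y : MatSpace m n => (ζᴴ * Y.toMatrix).trace := by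
    unfold MatSpace.toMatrix
    refine Continuous.matrix_trace (Continuous.matrix_mul continuous_const ?_)
    exact continuous_matrix fun i j => by fun_prop
  have hX : c < (ζᴴ * X.toMatrix).trace := by linarith
  filter_upwards [hcont.continuousAt.eventually (lt_mem_nhds hX)] with Y hY
  obtain ⟨P', S', -, hP', hS', hW, -⟩ := exists_nuclearNorm_certificate Y
  have h2 := hZ.trace_mul_nonneg hW
  rw [trace_fromBlocks_mul_fromBlocks] at h2
  linarith

end NuclearNorm

/-! ### Sums of extended-real-valued functions -/

theorem EReal.sum_ne_bot {κ : Type*} {s : Finset κ} {g : κ → EReal} (h : ∀ k ∈ s, g k ≠ ⊥) :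
    ∑ k ∈ s, g k ≠ ⊥ := by
  classical
  induction s using Finset.induction_on with
  | empty => simp
  | insert a s ha ih =>
    rw [Finset.sum_insert ha, Ne, EReal.add_eq_bot_iff, not_or]
    exact ⟨h a (Finset.mem_insert_self _ _),
      ih fun k hk => h k (Finset.mem_insert_of_mem hk)⟩

theorem EReal.ne_top_of_sum_ne_top {κ : Type*} [Fintype κ] {g : κ → EReal} (h : ∀ k, g k ≠ ⊥)
    (hs : ∑ k, g k ≠ ⊤) (k : κ) : g k ≠ ⊤ := by
  classical
  intro hk
  refine hs ?_
  rw [← Finset.add_sum_erase _ _ (Finset.mem_univ k), hk]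
  exact EReal.top_add_of_ne_bot (EReal.sum_ne_bot fun j _ => h j)

theorem EReal.coe_finset_sum {κ : Type*} (s : Finset κ) (g : κ → ℝ) :
    ((∑ k ∈ s, g k : ℝ) : EReal) = ∑ k ∈ s, (g k : EReal) := by
  classical
  induction s using Finset.induction_on with
  | empty => simp
  | insert a s ha ih => rw [Finset.sum_insert ha, Finset.sum_insert ha, EReal.coe_add, ih]

theorem LowerSemicontinuous.ereal_add {α : Type*} [TopologicalSpace α] {g h : α → EReal}
    (hg : LowerSemicontinuous g) (hh : LowerSemicontinuous h) (hg' : ∀ x, g x ≠ ⊥)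
    (hh' : ∀ x, h x ≠ ⊥) : LowerSemicontinuous fun x => g x + h x :=
  hg.add' hh fun x => EReal.continuousAt_add (Or.inr (hh' x)) (Or.inl (hg' x))

theorem LowerSemicontinuous.ereal_sum {α κ : Type*} [TopologicalSpace α] {g : κ → α → EReal}
    (s : Finset κ) (hg : ∀ k, LowerSemicontinuous (g k)) (hg' : ∀ k x, g k x ≠ ⊥) :
    LowerSemicontinuous fun x => ∑ k ∈ s, g k x := by
  classical
  induction s using Finset.induction_on with
  | empty => simpa using lowerSemicontinuous_const
  | insert a s ha ih =>
    simp only [Finset.sum_insert ha]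
    exact (hg a).ereal_add ih (hg' a) fun x => EReal.sum_ne_bot fun k _ => hg' k x

/-! ### The sum of LMI-representable functions and the nuclear norm -/

section NuclearSum

/-- The auxiliary variables `(t, U, V)` of the semidefinite program: the `t k` bound the values of
the LMI-representable functions, and `U`, `V` parametrize the diagonal blocks of the semidefinite
representation of the nuclear norm. -/
abbrev NuclearSumVar (m n p : ℕ) : Type :=
  (Fin p → ℝ) × (Fin m → Fin m → ℝ) × (Fin n → Fin n → ℝ)

/-- The symmetric matrix `U + Uᵀ`. -/
def symmetrize {N : ℕ} (U : Fin N → Fin N → ℝ) : Matrix (Fin N) (Fin N) ℝ :=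
  Matrix.of fun i j => U i j + U j i

theorem symmetrize_add {N : ℕ} (U V : Fin N → Fin N → ℝ) :
    symmetrize (U + V) = symmetrize U + symmetrize V := by
  ext i j
  simp only [symmetrize, Matrix.of_apply, Matrix.add_apply, Pi.add_apply]
  ring

theorem symmetrize_smul {N : ℕ} (r : ℝ) (U : Fin N → Fin N → ℝ) :
    symmetrize (r • U) = r • symmetrize U := by
  ext i j
  simp only [symmetrize, Matrix.of_apply, Matrix.smul_apply, Pi.smul_apply, smul_eq_mul]
  ring

theorem isHermitian_symmetrize {N : ℕ} (U : Fin N → Fin N → ℝ) : (symmetrize U).IsHermitian := by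
  ext i j
  simp [symmetrize, add_comm]

theorem trace_symmetrize {N : ℕ} (U : Fin N → Fin N → ℝ) :
    (symmetrize U).trace = 2 * ∑ i, U i i := by
  simp only [symmetrize, Matrix.trace, Matrix.diag_apply, Matrix.of_apply, Finset.mul_sum]
  exact Finset.sum_congr rfl fun i _ => by ring

theorem symmetrize_half {N : ℕ} {P : Matrix (Fin N) (Fin N) ℝ} (hP : P.IsHermitian) :
    symmetrize (fun i j => P i j / 2) = P := by
  ext i j
  have := hP.apply i j
  rw [star_trivial] at this
  simp only [symmetrize, Matrix.of_apply, this]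
  ring

variable {m n p : ℕ} {d : Fin p → ℕ}

/-- The constant part of the matrix of the semidefinite program. -/
noncomputable def nuclearSumConst (m n : ℕ)
    (A₀₀ : (k : Fin p) → Matrix (Fin (d k)) (Fin (d k)) ℝ) :
    Matrix ((Σ k, Fin (d k)) ⊕ (Fin m ⊕ Fin n)) ((Σ k, Fin (d k)) ⊕ (Fin m ⊕ Fin n)) ℝ :=
  Matrix.fromBlocks (Matrix.blockDiagonal' A₀₀) 0 0 0

/-- The linear part of the matrix of the semidefinite program. -/
noncomputable def nuclearSumMap (A₀ : (k : Fin p) → Matrix (Fin (d k)) (Fin (d k)) ℝ)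
    (A : (k : Fin p) → Fin m → Fin n → Matrix (Fin (d k)) (Fin (d k)) ℝ) :
    MatSpace m n × NuclearSumVar m n p →ₗ[ℝ]
      Matrix ((Σ k, Fin (d k)) ⊕ (Fin m ⊕ Fin n)) ((Σ k, Fin (d k)) ⊕ (Fin m ⊕ Fin n)) ℝ where
  toFun y := Matrix.fromBlocks
    (Matrix.blockDiagonal' fun k => lmiPencil 0 (A₀ k) (A k) y.1 (y.2.1 k)) 0 0
    (Matrix.fromBlocks (symmetrize y.2.2.1) y.1.toMatrix y.1.toMatrixᴴ
      (symmetrize y.2.2.2))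
  map_add' y z := by
    rw [Matrix.fromBlocks_add, ← Matrix.blockDiagonal'_add, add_zero, add_zero]
    congr 2
    · funext k
      simp only [Pi.add_apply, Prod.fst_add, Prod.snd_add]
      rw [← lmiPencil_add_add, add_zero]
    · rw [Matrix.fromBlocks_add, ← symmetrize_add, ← symmetrize_add]
      rfl
  map_smul' r y := by
    rw [RingHom.id_apply, Matrix.fromBlocks_smul,
      ← Matrix.blockDiagonal'_smul, smul_zero, smul_zero]
    congr 2
    · funext k
      simp only [Pi.smul_apply, Prod.smul_fst, Prod.smul_snd, smul_eq_mul]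
      rw [← lmiPencil_smul]
    · rw [Matrix.fromBlocks_smul, ← symmetrize_smul, ← symmetrize_smul]
      congr 1

/-- The objective of the semidefinite program. -/
noncomputable def nuclearSumCost (m n p : ℕ) : NuclearSumVar m n p →ₗ[ℝ] ℝ where
  toFun u := ∑ k, u.1 k + (∑ i, u.2.1 i i + ∑ j, u.2.2 j j)
  map_add' u v := by
    simp only [Prod.fst_add, Prod.snd_add, Pi.add_apply, Finset.sum_add_distrib]
    ring
  map_smul' r u := by
    simp only [Prod.smul_fst, Prod.smul_snd, Pi.smul_apply, ← Finset.smul_sum, ← smul_add,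
      RingHom.id_apply]

variable {A₀₀ A₀ : (k : Fin p) → Matrix (Fin (d k)) (Fin (d k)) ℝ}
  {A : (k : Fin p) → Fin m → Fin n → Matrix (Fin (d k)) (Fin (d k)) ℝ}

theorem nuclearSumConst_add_nuclearSumMap (X : MatSpace m n) (t : Fin p → ℝ)
    (U : Fin m → Fin m → ℝ) (V : Fin n → Fin n → ℝ) :
    nuclearSumConst m n A₀₀ + nuclearSumMap A₀ A (X, t, U, V) = Matrix.fromBlocks
      (Matrix.blockDiagonal' fun k => lmiPencil (A₀₀ k) (A₀ k) (A k) X (t k)) 0 0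
      (Matrix.fromBlocks (symmetrize U) X.toMatrix X.toMatrixᴴ
        (symmetrize V)) := by
  simp only [nuclearSumConst, nuclearSumMap, LinearMap.coe_mk, AddHom.coe_mk]
  rw [Matrix.fromBlocks_add, ← Matrix.blockDiagonal'_add, add_zero, add_zero, zero_add]
  congr 2
  funext k
  simp only [Pi.add_apply, lmiPencil]
  abel

variable {f : Fin p → MatSpace m n → EReal}

/-- Writing the diagonal blocks as `U + Uᵀ` and `V + Vᵀ` lets the variables range over a full vector
space. The diagonal sums in the cost are then half the traces of the blocks, as the nuclear norm
requires. -/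
theorem isSDPRepresentation_nuclearSum (hbot : ∀ k X, f k X ≠ ⊥)
    (hepi : ∀ k X t, f k X ≤ ((t : ℝ) : EReal) ↔
      (lmiPencil (A₀₀ k) (A₀ k) (A k) X t).PosSemidef)
    (hA₀₀ : ∀ k, (A₀₀ k).IsHermitian) (hA₀ : ∀ k, (A₀ k).IsHermitian)
    (hA : ∀ k i j, (A k i j).IsHermitian) :
    IsSDPRepresentation (fun X => (∑ k, f k X) + (nuclearNorm X : EReal))
      (nuclearSumConst m n A₀₀) (nuclearSumMap A₀ A) (nuclearSumCost m n p) where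
  isHermitian_const := Matrix.IsHermitian.fromBlocks (Matrix.isHermitian_blockDiagonal' hA₀₀)
    Matrix.conjTranspose_zero Matrix.isHermitian_zero
  isHermitian_map y := by
    refine Matrix.IsHermitian.fromBlocks (Matrix.isHermitian_blockDiagonal' fun k =>
      isHermitian_lmiPencil Matrix.isHermitian_zero (hA₀ k) (hA k) _ _) Matrix.conjTranspose_zero
      (Matrix.IsHermitian.fromBlocks ?_ rfl ?_)
    all_goals exact isHermitian_symmetrize _
  ne_bot X := by
    rw [Ne, EReal.add_eq_bot_iff, not_or]
    exact ⟨EReal.sum_ne_bot fun k _ => hbot k X, EReal.coe_ne_bot _⟩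
  le_iff X τ := by
    constructor
    · intro h
      have hsum : ∑ k, f k X ≠ ⊤ := by
        intro h'
        rw [h', EReal.top_add_coe] at h
        exact absurd h (by simp)
      have hr : ∀ k, f k X = ((f k X).toReal : EReal) := fun k =>
        (EReal.coe_toReal (EReal.ne_top_of_sum_ne_top (fun k => hbot k X) hsum k) (hbot k X)).symm
      obtain ⟨P, S, ζ, hP, hS, hpsd, -⟩ := exists_nuclearNorm_certificate X
      have hPh : P.IsHermitian := (hpsd.submatrix Sum.inl).isHermitian
      have hSh : S.IsHermitian := (hpsd.submatrix Sum.inr).isHermitian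
      refine ⟨(fun k => (f k X).toReal, fun i j => P i j / 2, fun i j => S i j / 2), ?_, ?_⟩
      · rw [nuclearSumConst_add_nuclearSumMap, Matrix.posSemidef_fromBlocks_zero_iff,
          Matrix.posSemidef_blockDiagonal'_iff,
          symmetrize_half hPh, symmetrize_half hSh]
        exact ⟨fun k => (hepi k X _).mp (hr k).le, hpsd⟩
      · have e : nuclearSumCost m n p
            (fun k => (f k X).toReal, fun i j => P i j / 2, fun i j => S i j / 2) =
            ∑ k, (f k X).toReal + nuclearNorm X := by
          change _ + (∑ i, P i i / 2 + ∑ j, S j j / 2) = _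
          simp only [Matrix.trace, Matrix.diag_apply] at hP hS
          rw [← Finset.sum_div, ← Finset.sum_div, hP, hS]
          ring
        rw [e, ← EReal.coe_le_coe_iff, EReal.coe_add, EReal.coe_finset_sum]
        simpa only [← hr] using h
    · rintro ⟨⟨t, U, V⟩, hpsd, hc⟩
      rw [nuclearSumConst_add_nuclearSumMap, Matrix.posSemidef_fromBlocks_zero_iff,
        Matrix.posSemidef_blockDiagonal'_iff] at hpsd
      have h1 := two_mul_nuclearNorm_le hpsd.2
      rw [trace_symmetrize, trace_symmetrize] at h1
      have hc' : ∑ k, t k + (∑ i, U i i + ∑ j, V j j) ≤ τ := hc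
      calc (∑ k, f k X) + (nuclearNorm X : EReal)
          ≤ ∑ k, (t k : EReal) + (nuclearNorm X : EReal) := by
            gcongr with k
            exact (hepi k X (t k)).mpr (hpsd.1 k)
        _ = ((∑ k, t k + nuclearNorm X : ℝ) : EReal) := by
            rw [EReal.coe_add, EReal.coe_finset_sum]
        _ ≤ τ := by
            rw [EReal.coe_le_coe_iff]
            linarith

/-- The nuclear norm block imposes no further Slater condition: adding the identity to its
certificate makes it positive definite. -/
theorem exists_posDef_nuclearSum {X : MatSpace m n} {s : Fin p → ℝ}
    (h : ∀ k, (lmiPencil (A₀₀ k) (A₀ k) (A k) X (s k)).PosDef) :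
    ∃ w, (nuclearSumConst m n A₀₀ + nuclearSumMap A₀ A w).PosDef := by
  obtain ⟨P, S, ζ, -, -, hpsd, -⟩ := exists_nuclearNorm_certificate X
  have hP : (P + 1).IsHermitian :=
    (hpsd.submatrix Sum.inl).isHermitian.add Matrix.isHermitian_one
  have hS : (S + 1).IsHermitian :=
    (hpsd.submatrix Sum.inr).isHermitian.add Matrix.isHermitian_one
  refine ⟨(X, s, fun i j => (P + 1) i j / 2, fun i j => (S + 1) i j / 2), ?_⟩
  rw [nuclearSumConst_add_nuclearSumMap, symmetrize_half hP,
    symmetrize_half hS]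
  refine Matrix.PosDef.fromBlocks_zero (Matrix.PosDef.blockDiagonal' h) ?_
  have : Matrix.fromBlocks (P + 1) X.toMatrix X.toMatrixᴴ (S + 1) =
      1 + Matrix.fromBlocks P X.toMatrix X.toMatrixᴴ S := by
    rw [← Matrix.fromBlocks_one, Matrix.fromBlocks_add, zero_add, zero_add, add_comm P,
      add_comm S]
  rw [this]
  exact Matrix.PosDef.one.add_posSemidef hpsd

theorem trace_multiplier_mul_nuclearSumMap {Z : (k : Fin p) → Matrix (Fin (d k)) (Fin (d k)) ℝ}
    (hZ : ∀ k, (Z k * A₀ k).trace = 1) (ζ : Matrix (Fin m) (Fin n) ℝ)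
    (u : NuclearSumVar m n p) :
    (Matrix.fromBlocks (Matrix.blockDiagonal' Z) 0 0
      ((1 / 2 : ℝ) • Matrix.fromBlocks 1 (-ζ) (-ζᴴ) 1) *
        nuclearSumMap A₀ A (0, u)).trace = nuclearSumCost m n p u := by
  have h0 : (0 : MatSpace m n).toMatrix = 0 := rfl
  simp only [nuclearSumMap, nuclearSumCost, LinearMap.coe_mk, AddHom.coe_mk]
  rw [Matrix.fromBlocks_multiply, Matrix.trace_fromBlocks, Matrix.zero_mul, Matrix.zero_mul,
    add_zero, zero_add, ← Matrix.blockDiagonal'_mul, Matrix.trace_blockDiagonal',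
    Matrix.smul_mul, Matrix.trace_smul, trace_fromBlocks_mul_fromBlocks, h0, Matrix.mul_zero,
    Matrix.trace_zero, trace_symmetrize, trace_symmetrize, smul_eq_mul]
  congr 1
  · refine Finset.sum_congr rfl fun k _ => ?_
    have : lmiPencil 0 (A₀ k) (A k) 0 (u.1 k) = u.1 k • A₀ k := by simp [lmiPencil]
    rw [this, Matrix.mul_smul, Matrix.trace_smul, hZ, smul_eq_mul, mul_one]
  · ring

/-- Each `t k` is bounded below through its multiplier, and the nuclear norm block has nonnegative
trace. A cap on the cost therefore bounds every `t k`, and that trace, from above. -/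
theorem exists_trace_le_nuclearSum {Z : (k : Fin p) → Matrix (Fin (d k)) (Fin (d k)) ℝ}
    (hZ : ∀ k, (Z k).PosSemidef) (hZA : ∀ k, (Z k * A₀ k).trace = 1)
    (hA₀ : ∀ k, (A₀ k).PosSemidef) (X₀ : MatSpace m n) (r : ℝ) :
    ∃ B : ℝ, ∀ X u, ‖X - X₀‖ ≤ 1 → nuclearSumCost m n p u ≤ r →
      (nuclearSumConst m n A₀₀ + nuclearSumMap A₀ A (X, u)).PosSemidef →
      (nuclearSumConst m n A₀₀ + nuclearSumMap A₀ A (X, u)).trace ≤ B := by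
  choose a D h using fun k =>
    exists_bounds_of_posSemidef_lmiPencil (B := A₀₀ k) (A := A k) (hZ k) (hZA k) X₀
  refine ⟨∑ k, (D k + (a k + (r - ∑ j, a j)) * (A₀ k).trace) + 2 * (r - ∑ j, a j), ?_⟩
  rintro X ⟨t, U, V⟩ hX hc hpsd
  rw [nuclearSumConst_add_nuclearSumMap] at hpsd ⊢
  rw [Matrix.posSemidef_fromBlocks_zero_iff, Matrix.posSemidef_blockDiagonal'_iff] at hpsd
  have hW := hpsd.2.trace_nonneg
  rw [Matrix.trace_fromBlocks, trace_symmetrize, trace_symmetrize] at hW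
  have hc' : ∑ k, t k + (∑ i, U i i + ∑ j, V j j) ≤ r := hc
  have ht : ∀ k, a k ≤ t k := fun k => (h k X (t k) hX (hpsd.1 k)).1
  have hsum : ∑ k, a k ≤ ∑ k, t k := Finset.sum_le_sum fun k _ => ht k
  have ht' : ∀ k, t k ≤ a k + (r - ∑ j, a j) := by
    intro k
    have := Finset.single_le_sum (f := fun j => t j - a j) (fun j _ => sub_nonneg.mpr (ht j))
      (Finset.mem_univ k)
    rw [Finset.sum_sub_distrib] at this
    linarith
  rw [Matrix.trace_fromBlocks, Matrix.trace_fromBlocks, trace_symmetrize,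
    trace_symmetrize, Matrix.trace_blockDiagonal']
  refine add_le_add (Finset.sum_le_sum fun k _ => ?_) (by linarith)
  refine (h k X (t k) hX (hpsd.1 k)).2.trans ?_
  have := (hA₀ k).trace_nonneg
  have := ht' k
  gcongr

end NuclearSum

/-! ### The Kurdyka-Łojasiewicz exponent of the sum -/

theorem mainTheorem5 {m n p : ℕ}
    (f : Fin p → MatSpace m n → EReal)
    (hf : ∀ k, IsProperClosed (f k))
    (d : Fin p → ℕ)
    (A₀₀ A₀ : (k : Fin p) → Matrix (Fin (d k)) (Fin (d k)) ℝ)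
    (A : (k : Fin p) → Fin m → Fin n → Matrix (Fin (d k)) (Fin (d k)) ℝ)
    (hA₀₀ : ∀ k, (A₀₀ k).IsSymm)
    (hA₀ : ∀ k, (A₀ k).IsSymm)
    (hA : ∀ k i j, (A k i j).IsSymm)
    (hepi : ∀ k, epi (f k) =
      {q : MatSpace m n × ℝ | (lmiPencil (A₀₀ k) (A₀ k) (A k) q.1 q.2).PosSemidef})
    (hSlater : ∃ (Xs : MatSpace m n) (s : Fin p → ℝ),
      ∀ k, (lmiPencil (A₀₀ k) (A₀ k) (A k) Xs (s k)).PosDef)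
    (Xbar : MatSpace m n)
    (hdom : Xbar ∈ domSubdifferential
      (fun X : MatSpace m n => (∑ k, f k X) + (nuclearNorm X : EReal)))
    (hri : (0 : MatSpace m n) ∈ intrinsicInterior ℝ (limitingSubdifferential
      (fun X : MatSpace m n => (∑ k, f k X) + (nuclearNorm X : EReal)) Xbar)) :
    HasKLExponent (fun X : MatSpace m n => (∑ k, f k X) + (nuclearNorm X : EReal))
      Xbar (1 / 2) := by
  have hbot : ∀ k X, f k X ≠ ⊥ := fun k => (hf k).1.1
  have hepi' : ∀ k X t, f k X ≤ ((t : ℝ) : EReal) ↔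
      (lmiPencil (A₀₀ k) (A₀ k) (A k) X t).PosSemidef := fun k X t =>
    Set.ext_iff.mp (hepi k) (X, t)
  have hA₀' : ∀ k, (A₀ k).IsHermitian := fun k => by
    rw [Matrix.IsHermitian, Matrix.conjTranspose_eq_transpose_of_trivial, (hA₀ k).eq]
  have hrep := isSDPRepresentation_nuclearSum hbot hepi'
    (fun k => by rw [Matrix.IsHermitian, Matrix.conjTranspose_eq_transpose_of_trivial,
      (hA₀₀ k).eq]) hA₀'
    (fun k i j => by rw [Matrix.IsHermitian, Matrix.conjTranspose_eq_transpose_of_trivial,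
      (hA k i j).eq])
  have hlt : (∑ k, f k Xbar) + (nuclearNorm Xbar : EReal) < ⊤ := by
    obtain ⟨ζ, hζ⟩ := hdom
    exact hζ.1
  have hsum : ∑ k, f k Xbar ≠ ⊤ := fun h => by simp [h] at hlt
  have hr : ∀ k, f k Xbar = ((f k Xbar).toReal : EReal) := fun k =>
    (EReal.coe_toReal (EReal.ne_top_of_sum_ne_top (fun k => hbot k _) hsum k) (hbot k _)).symm
  obtain ⟨Xs, s, hs⟩ := hSlater
  obtain ⟨w, hw⟩ := exists_posDef_nuclearSum hs
  choose Z hZ hZP hZpd hZA using fun k => exists_multiplier (hepi' k) (hA₀' k) (hr k)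
  obtain ⟨P, S, ζ, hP, hS, hW, hN, hNW, hNpd⟩ := exists_nuclearNorm_certificate Xbar
  have hPh : P.IsHermitian := (hW.submatrix Sum.inl).isHermitian
  have hSh : S.IsHermitian := (hW.submatrix Sum.inr).isHermitian
  set u₀ : NuclearSumVar m n p :=
    (fun k => (f k Xbar).toReal, fun i j => P i j / 2, fun i j => S i j / 2) with hu₀
  have hM : nuclearSumConst m n A₀₀ + nuclearSumMap A₀ A (Xbar, u₀) = Matrix.fromBlocks
      (Matrix.blockDiagonal' fun k =>
        lmiPencil (A₀₀ k) (A₀ k) (A k) Xbar (f k Xbar).toReal) 0 0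
      (Matrix.fromBlocks P Xbar.toMatrix Xbar.toMatrixᴴ S) := by
    rw [hu₀, nuclearSumConst_add_nuclearSumMap, symmetrize_half hPh, symmetrize_half hSh]
  have hval : (∑ k, f k Xbar) + (nuclearNorm Xbar : EReal) = nuclearSumCost m n p u₀ := by
    have e : nuclearSumCost m n p u₀ = ∑ k, (f k Xbar).toReal + nuclearNorm Xbar := by
      change _ + (∑ i, P i i / 2 + ∑ j, S j j / 2) = _
      simp only [Matrix.trace, Matrix.diag_apply] at hP hS
      rw [← Finset.sum_div, ← Finset.sum_div, hP, hS]
      ring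
    rw [e, EReal.coe_add, EReal.coe_finset_sum]
    simp only [← hr]
  -- This multiplier represents some subgradient at `Xbar`, in general not `0`; `hri` enters only
  -- when it is replaced by `Z'`.
  have hcert : IsStrictlyComplementary (nuclearSumConst m n A₀₀) (nuclearSumMap A₀ A)
      (nuclearSumCost m n p) Xbar u₀ (Matrix.fromBlocks (Matrix.blockDiagonal' Z) 0 0
        ((1 / 2 : ℝ) • Matrix.fromBlocks 1 (-ζ) (-ζᴴ) 1)) :=
    { primal := by
        rw [hM, Matrix.posSemidef_fromBlocks_zero_iff, Matrix.posSemidef_blockDiagonal'_iff]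
        exact ⟨fun k => (hepi' k _ _).mp (hr k).le, hW⟩
      dual := by
        rw [Matrix.posSemidef_fromBlocks_zero_iff, Matrix.posSemidef_blockDiagonal'_iff]
        exact ⟨hZ, hN.smul (by norm_num)⟩
      mul_eq_zero := by
        rw [hM, Matrix.fromBlocks_multiply, ← Matrix.blockDiagonal'_mul]
        have h0 : Matrix.blockDiagonal' (fun k => (0 : Matrix (Fin (d k)) (Fin (d k)) ℝ)) = 0 :=
          Matrix.blockDiagonal'_zero
        simp only [Matrix.smul_mul, hNW, hZP, h0]
        simp
      posDef := by
        rw [hM, Matrix.fromBlocks_add, ← Matrix.blockDiagonal'_add, add_zero, add_zero]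
        exact Matrix.PosDef.fromBlocks_zero (Matrix.PosDef.blockDiagonal' hZpd)
          (Matrix.PosDef.smul_add hN hW hNpd (by norm_num))
      trace_mul := trace_multiplier_mul_nuclearSumMap hZA ζ }
  obtain ⟨Z', hZ', hZ'0⟩ := hrep.exists_isStrictlyComplementary hw hval hcert hri
  obtain ⟨B, hB⟩ := exists_trace_le_nuclearSum (A₀₀ := A₀₀) (A := A) hZ hZA
    (fun k => posSemidef_of_epi_eq (hepi' k) (hA₀' k) (hr k)) Xbar (nuclearSumCost m n p u₀ + 1)
  obtain ⟨C, hC, δ, hδ, hgrowth⟩ := hrep.exists_quadratic_growth hZ' hZ'0 hB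
  refine hasKLExponent_half_of_quadratic_growth ⟨⟨hrep.ne_bot, Xbar, hlt⟩, ?_⟩ hrep.isConvexFun
    hval hdom hC hδ hgrowth
  exact (LowerSemicontinuous.ereal_sum _ (fun k => (hf k).2) hbot).ereal_add
    (continuous_coe_real_ereal.comp_lowerSemicontinuous lowerSemicontinuous_nuclearNorm
      EReal.coe_strictMono.monotone)
    (fun X => EReal.sum_ne_bot fun k _ => hbot k X) fun X => EReal.coe_ne_bot _
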